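/- Consider the allocation of $m\ge 0$ indivisible goods to $n\ge 1$ agents. Each agent $i$ has an additive valuation $v_i:2^{\mathcal G}\to\mathbb R_{\ge 0}$ and an additive social impact function $s_i:2^{\mathcal G}\to\mathbb R_{\ge 0}$ on the set $\mathcal G$ of goods, both given by their values on single goods. An allocation $\mathcal A=(A_1,\dots,A_n)$ is a partition of $\mathcal G$ into $n$ pairwise disjoint, possibly empty bundles. It is $\mathsf{EF2}$ (envy-free up to two goods) if for all agents $i,j$ there is a set $R\subseteq A_j$ of at most two goods with $v_i(A_i)\ge v_i(A_j\setminus R)$. Its utilitarian social impact is $\mathsf{SW}(\mathcal A)=\sum_{i} s_i(A_i)$, and $\mathsf{opt}$ is the maximum of $\mathsf{SW}$ over all allocations. Theorem. There is a polynomial-time algorithm that, on every such instance, computes an $\mathsf{EF2}$ allocation $\mathcal A$ with $n\cdot\mathsf{SW}(\mathcal A)\ge \mathsf{opt}$. Here an algorithm is one fixed deterministic while program with arrays of natural and of real numbers, in which the only operations on real numbers are copying, addition, comparison and the constant $0$, and the only operations on natural numbers are constants, addition, truncated subtraction and comparison, each at unit cost; polynomial time means that the number of steps is at most $p(n+m)$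 for one fixed polynomial $p$. -/

import Mathlib

namespace SocialImpact

/-! ### Fair division with social impact -/

/-- An instance with agents `Fin n` and goods `Fin m`. Valuations and social impacts are additive,
hence given by their values on single goods: `v i g` is the value of good `g` for agent `i`, and
`s i g` is the social impact of giving `g` to `i`. -/
structure FairInstance (n m : ℕ) where
  v : Fin n → Fin m → ℝ
  s : Fin n → Fin m → ℝ
  v_nonneg : ∀ i g, 0 ≤ v i g
  s_nonneg : ∀ i g, 0 ≤ s i g

/-- The additive extension of a function on goods to bundles of goods. -/
def bundleValue {m : ℕ} (f : Fin m → ℝ) (B : Finset (Fin m)) : ℝ := ∑ g ∈ B, f g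

/-- A complete allocation: pairwise disjoint bundles that together contain every good. -/
structure Allocation (n m : ℕ) where
  bundle : Fin n → Finset (Fin m)
  disjoint : ∀ i j, i ≠ j → Disjoint (bundle i) (bundle j)
  complete : ∀ g, ∃ i, g ∈ bundle i

/-- Envy-freeness up to `k` goods: for all agents `i`, `j`, after the removal of at most `k` goods
from the bundle of `j`, agent `i` does not prefer it to her own bundle. -/
def IsEFk {n m : ℕ} (k : ℕ) (I : FairInstance n m) (A : Allocation n m) : Prop :=
  ∀ i j : Fin n, ∃ R : Finset (Fin m), R ⊆ A.bundle j ∧ R.card ≤ k ∧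
    bundleValue (I.v i) (A.bundle j \ R) ≤ bundleValue (I.v i) (A.bundle i)

/-- The utilitarian social welfare `SW(A) = ∑ i, s_i(A_i)`. -/
def socialWelfare {n m : ℕ} (I : FairInstance n m) (A : Allocation n m) : ℝ :=
  ∑ i, bundleValue (I.s i) (A.bundle i)

/-- `A` is a `c`-approximation of the maximum utilitarian social welfare `opt`, i.e.
`opt ≤ c * SW(A)`, where `opt` is the largest welfare of a complete allocation. -/
def IsMaxUtApprox {n m : ℕ} (c : ℝ) (I : FairInstance n m) (A : Allocation n m) : Prop :=
  ∀ B : Allocation n m, socialWelfare I B ≤ c * socialWelfare I A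

/-! ### The machine model

Deterministic while programs over two kinds of memory: natural numbers (for counters and indices)
and real numbers (for the values in the input), each organised in two-dimensional arrays that are
named by natural numbers. The only operations on reals are copying, addition and comparison, and
those on naturals are constants, addition, truncated subtraction and comparison. There is no
multiplication, no real constant except `0`, and no conversion between the two kinds.
Every operation costs one unit. As `t` operations increase the bit length of the
numbers that occur by at most `t`, up to the total bit length of the input, a program that makes
polynomially many steps also runs in polynomial time on a Turing machine when the inputs are
rational numbers in binary notation. -/

/-- The memory: the contents of cell `(i, j)` of array `a`, for both kinds. -/
structure Mem where
  nat : ℕ → ℕ → ℕ → ℕ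
  real : ℕ → ℕ → ℕ → ℝ

/-- Writing a natural number to a cell. -/
def Mem.writeNat (σ : Mem) (a i j x : ℕ) : Mem where
  nat := fun a' i' j' => if a' = a ∧ i' = i ∧ j' = j then x else σ.nat a' i' j'
  real := σ.real

/-- Writing a real number to a cell. -/
noncomputable def Mem.writeReal (σ : Mem) (a i j : ℕ) (x : ℝ) : Mem where
  nat := σ.nat
  real := fun a' i' j' => if a' = a ∧ i' = i ∧ j' = j then x else σ.real a' i' j'

/-- Expressions for natural numbers; `read a i j` reads cell `(i, j)` of array `a`. -/
inductive NExp where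
  | const (k : ℕ)
  | read (a : ℕ) (i j : NExp)
  | add (e f : NExp)
  | sub (e f : NExp)

/-- Expressions for real numbers. -/
inductive RExp where
  | zero
  | read (a : ℕ) (i j : NExp)
  | add (e f : RExp)

/-- Tests. -/
inductive BExp where
  | natLe (e f : NExp)
  | realLe (e f : RExp)
  | not (b : BExp)
  | and (b c : BExp)

/-- Commands. -/
inductive Cmd where
  | skip
  | setNat (a : ℕ) (i j e : NExp)
  | setReal (a : ℕ) (i j : NExp) (e : RExp)
  | seq (c d : Cmd)
  | ite (b : BExp) (c d : Cmd)
  | loop (b : BExp) (c : Cmd)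

def NExp.eval (σ : Mem) : NExp → ℕ
  | .const k => k
  | .read a i j => σ.nat a (i.eval σ) (j.eval σ)
  | .add e f => e.eval σ + f.eval σ
  | .sub e f => e.eval σ - f.eval σ

def RExp.eval (σ : Mem) : RExp → ℝ
  | .zero => 0
  | .read a i j => σ.real a (i.eval σ) (j.eval σ)
  | .add e f => e.eval σ + f.eval σ

def BExp.Holds (σ : Mem) : BExp → Prop
  | .natLe e f => e.eval σ ≤ f.eval σ
  | .realLe e f => e.eval σ ≤ f.eval σ
  | .not b => ¬ b.Holds σ
  | .and b c => b.Holds σ ∧ c.Holds σ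

/-- The cost of an evaluation: one unit for every node of the expression. -/
def NExp.cost : NExp → ℕ
  | .const _ => 1
  | .read _ i j => i.cost + j.cost + 1
  | .add e f => e.cost + f.cost + 1
  | .sub e f => e.cost + f.cost + 1

def RExp.cost : RExp → ℕ
  | .zero => 1
  | .read _ i j => i.cost + j.cost + 1
  | .add e f => e.cost + f.cost + 1

def BExp.cost : BExp → ℕ
  | .natLe e f => e.cost + f.cost + 1
  | .realLe e f => e.cost + f.cost + 1
  | .not b => b.cost + 1
  | .and b c => b.cost + c.cost + 1

/-- `Exec c σ t τ`: started with memory `σ`, the program `c` halts after exactly `t` steps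
with memory `τ`. -/
inductive Exec : Cmd → Mem → ℕ → Mem → Prop where
  | skip (σ : Mem) : Exec .skip σ 1 σ
  | setNat (a : ℕ) (i j e : NExp) (σ : Mem) :
      Exec (.setNat a i j e) σ (i.cost + j.cost + e.cost + 1)
        (σ.writeNat a (i.eval σ) (j.eval σ) (e.eval σ))
  | setReal (a : ℕ) (i j : NExp) (e : RExp) (σ : Mem) :
      Exec (.setReal a i j e) σ (i.cost + j.cost + e.cost + 1)
        (σ.writeReal a (i.eval σ) (j.eval σ) (e.eval σ))
  | seq {c d : Cmd} {σ τ ρ : Mem} {t u : ℕ} (hc : Exec c σ t τ) (hd : Exec d τ u ρ) :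
      Exec (.seq c d) σ (t + u) ρ
  | iteTrue {b : BExp} {c d : Cmd} {σ τ : Mem} {t : ℕ} (hb : b.Holds σ) (hc : Exec c σ t τ) :
      Exec (.ite b c d) σ (b.cost + t + 1) τ
  | iteFalse {b : BExp} {c d : Cmd} {σ τ : Mem} {t : ℕ} (hb : ¬ b.Holds σ) (hd : Exec d σ t τ) :
      Exec (.ite b c d) σ (b.cost + t + 1) τ
  | loopFalse {b : BExp} {c : Cmd} {σ : Mem} (hb : ¬ b.Holds σ) :
      Exec (.loop b c) σ (b.cost + 1) σ
  | loopTrue {b : BExp} {c : Cmd} {σ τ ρ : Mem} {t u : ℕ} (hb : b.Holds σ)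
      (hc : Exec c σ t τ) (hl : Exec (.loop b c) τ u ρ) :
      Exec (.loop b c) σ (b.cost + t + u + 1) ρ

/-- The memory that holds the input: `n` and `m` in cells `(0, 0)` and `(0, 1)` of array `0` of
naturals, the valuations in array `0` and the social impacts in array `1` of reals, and `0`
elsewhere. -/
noncomputable def inputMem {n m : ℕ} (I : FairInstance n m) : Mem where
  nat := fun a i j => if a = 0 ∧ i = 0 ∧ j = 0 then n else if a = 0 ∧ i = 0 ∧ j = 1 then m else 0
  real := fun a i j =>
    if h : i < n ∧ j < m then
      if a = 0 then I.v ⟨i, h.1⟩ ⟨j, h.2⟩ else if a = 1 then I.s ⟨i, h.1⟩ ⟨j, h.2⟩ else 0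
    else 0

/-- The memory `σ` holds `A` as output: cell `(0, g)` of array `1` of naturals is the agent who
receives good `g`. -/
def IsOutput {n m : ℕ} (σ : Mem) (A : Allocation n m) : Prop :=
  ∀ (i : Fin n) (g : Fin m), g ∈ A.bundle i ↔ σ.nat 1 0 g = i

end SocialImpact

namespace SocialImpact

/-! ### Reading from memory after writing -/

/-! Let the owner of a good be an agent for whom its social impact is largest, so that `opt` is at
most the sum over `o` of `s o` over the goods owned by `o`. It is enough that each agent `o`
receives at least a `1/n` share, measured by `s o`, of the goods that it owns.

The owners are treated one after another. The best good of `o` for `s o` is set aside as the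
permanent good of `o`. The remaining goods of `o` are distributed in blocks of the `n` best ones,
the last block being possibly smaller, over `n` bundles; a full block contributes one good to each
bundle. The permanent good is worth at least each good of the first block, and the worst good of a
full block at least each good of the next one. Hence every bundle, together with the permanent good,
reaches the share, no matter how the goods of a block are distributed (`Progress.blockStep`). As
this holds for every bundle, the bundles may change hands freely.

This freedom keeps the bundles envy-free up to one good for `v`. Before each block the agents trade
whole bundles along top trading cycles (`TradeState.round`): nobody loses, and nobody envies an
agent who left the trade in the same round or later. Then the agents pick from the block, those who
left last picking first (`PickState.pick`). An agent who has not yet picked did not envy the picker,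
so the removal of the new good removes any envy. An agent who has picked took a good worth at least
as much to it as the new one, which preserves the earlier comparison up to one good. Finally each
agent receives its permanent good, at most one, which gives `EF2` (`Outcome.envyFree`).

The algorithm is written in a language `Prog` with counted loops only. `exec_toCmd` translates its
denotational semantics into executions with a polynomial time bound, so that correctness is proved
with the invariant rule `run_rep`. -/

@[simp]
theorem Mem.writeNat_real (σ : Mem) (a i j x : ℕ) : (σ.writeNat a i j x).real = σ.real := rfl

@[simp]
theorem Mem.writeReal_nat (σ : Mem) (a i j : ℕ) (x : ℝ) :
    (σ.writeReal a i j x).nat = σ.nat := rfl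

@[simp]
theorem Mem.writeNat_nat_of_ne (σ : Mem) {a b : ℕ} (h : b ≠ a) (i j x : ℕ) :
    (σ.writeNat a i j x).nat b = σ.nat b := by
  funext y z
  simp [Mem.writeNat, h]

@[simp]
theorem Mem.writeReal_real_of_ne (σ : Mem) {a b : ℕ} (h : b ≠ a) (i j : ℕ) (x : ℝ) :
    (σ.writeReal a i j x).real b = σ.real b := by
  funext y z
  simp [Mem.writeReal, h]

@[simp]
theorem Mem.writeNat_nat (σ : Mem) (a i j x i' j' : ℕ) :
    (σ.writeNat a i j x).nat a i' j' = if i' = i ∧ j' = j then x else σ.nat a i' j' := by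
  simp [Mem.writeNat]

@[simp]
theorem Mem.writeReal_real (σ : Mem) (a i j : ℕ) (x : ℝ) (i' j' : ℕ) :
    (σ.writeReal a i j x).real a i' j' = if i' = i ∧ j' = j then x else σ.real a i' j' := by
  simp [Mem.writeReal]

/-! ### Programs with bounded loops -/

/-- Programs whose only loops are counted loops: `rep c b p` runs `p` with the counter in cell
`(0, 0)` of array `c` ranging over the natural numbers below the input in cell `(0, b)` of
array `0`. -/
inductive Prog where
  | setNat (a : ℕ) (i j e : NExp)
  | setReal (a : ℕ) (i j : NExp) (e : RExp)
  | seq (p q : Prog)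
  | cond (b : BExp) (p : Prog)
  | rep (c b : ℕ) (p : Prog)

namespace Prog

/-- The scalar in cell `(0, 0)` of array `a`. -/
abbrev scalar (a : ℕ) : NExp := .read a (.const 0) (.const 0)

/-- The entry `i` of the one-dimensional array in row `0` of array `a`. -/
abbrev entry (a : ℕ) (i : NExp) : NExp := .read a (.const 0) i

/-- The input in cell `(0, b)` of array `0`. -/
abbrev bound (b : ℕ) : NExp := .read 0 (.const 0) (.const b)

/-- The increment of a counter. -/
abbrev incr (c : ℕ) : Cmd :=
  .setNat c (.const 0) (.const 0) (.add (scalar c) (.const 1))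

def toCmd : Prog → Cmd
  | setNat a i j e => .setNat a i j e
  | setReal a i j e => .setReal a i j e
  | seq p q => .seq p.toCmd q.toCmd
  | cond b p => .ite b p.toCmd .skip
  | rep c b p => .seq (.setNat c (.const 0) (.const 0) (.const 0))
      (.loop (.natLe (.add (scalar c) (.const 1)) (bound b)) (.seq p.toCmd (incr c)))

open Classical in
/-- The effect of a program on the memory. -/
noncomputable def run : Prog → Mem → Mem
  | setNat a i j e, σ => σ.writeNat a (i.eval σ) (j.eval σ) (e.eval σ)
  | setReal a i j e, σ => σ.writeReal a (i.eval σ) (j.eval σ) (e.eval σ)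
  | seq p q, σ => q.run (p.run σ)
  | cond b p, σ => if b.Holds σ then p.run σ else σ
  | rep c b p, σ => (fun τ => (p.run τ).writeNat c 0 0 ((p.run τ).nat c 0 0 + 1))^[σ.nat 0 0 b]
      (σ.writeNat c 0 0 0)

theorem run_seq (p q : Prog) (σ : Mem) : (seq p q).run σ = q.run (p.run σ) := rfl

theorem run_setNat (a : ℕ) (i j e : NExp) (σ : Mem) :
    (setNat a i j e).run σ = σ.writeNat a (i.eval σ) (j.eval σ) (e.eval σ) := rfl

theorem run_setReal (a : ℕ) (i j : NExp) (e : RExp) (σ : Mem) :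
    (setReal a i j e).run σ = σ.writeReal a (i.eval σ) (j.eval σ) (e.eval σ) := rfl

theorem run_cond_of_holds {b : BExp} {σ : Mem} (h : b.Holds σ) (p : Prog) :
    (cond b p).run σ = p.run σ := if_pos h

theorem run_cond_of_not_holds {b : BExp} {σ : Mem} (h : ¬ b.Holds σ) (p : Prog) :
    (cond b p).run σ = σ := if_neg h

/-- The arrays of naturals to which a program writes. -/
def natWrites : Prog → List ℕ
  | setNat a _ _ _ => [a]
  | setReal _ _ _ _ => []
  | seq p q => p.natWrites ++ q.natWrites
  | cond _ p => p.natWrites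
  | rep c _ p => c :: p.natWrites

/-- The arrays of reals to which a program writes. -/
def realWrites : Prog → List ℕ
  | setNat _ _ _ _ => []
  | setReal a _ _ _ => [a]
  | seq p q => p.realWrites ++ q.realWrites
  | cond _ p => p.realWrites
  | rep _ _ p => p.realWrites

/-- The bodies of loops do not change the counter. -/
def WellFormed : Prog → Prop
  | setNat _ _ _ _ => True
  | setReal _ _ _ _ => True
  | seq p q => p.WellFormed ∧ q.WellFormed
  | cond _ p => p.WellFormed
  | rep c _ p => p.WellFormed ∧ c ∉ p.natWrites

/-- A bound on the running time in terms of a bound on the inputs. -/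
noncomputable def time : Prog → Polynomial ℕ
  | setNat _ i j e => .C (i.cost + j.cost + e.cost + 1)
  | setReal _ i j e => .C (i.cost + j.cost + e.cost + 1)
  | seq p q => p.time + q.time
  | cond b p => p.time + .C (b.cost + 2)
  | rep _ _ p => .X * (p.time + .C 18) + .C 14

/-- The frame rule. For concrete programs the hypothesis is settled by `decide`, so invariants need
to mention only the arrays that change. -/
theorem run_nat_of_notMem (p : Prog) {a : ℕ} (h : a ∉ p.natWrites) (σ : Mem) :
    (p.run σ).nat a = σ.nat a := by
  induction p generalizing σ with
  | setNat b i j e =>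
    have : a ≠ b := by simpa [natWrites] using h
    funext x y
    simp [run, Mem.writeNat, this]
  | setReal b i j e => rfl
  | seq p q hp hq =>
    simp only [natWrites, List.mem_append, not_or] at h
    rw [run, hq h.2, hp h.1]
  | cond b p hp =>
    rw [run]
    split
    · exact hp h σ
    · rfl
  | rep c b p hp =>
    simp only [natWrites, List.mem_cons, not_or] at h
    rw [run]
    have hw : ∀ (τ : Mem) (x : ℕ), (τ.writeNat c 0 0 x).nat a = τ.nat a := by
      intro τ x
      funext y z
      simp [Mem.writeNat, h.1]
    generalize σ.nat 0 0 b = k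
    induction k with
    | zero => exact hw _ _
    | succ k ih => rw [Function.iterate_succ_apply', hw, hp h.2, ih]

theorem run_real_of_notMem (p : Prog) {a : ℕ} (h : a ∉ p.realWrites) (σ : Mem) :
    (p.run σ).real a = σ.real a := by
  induction p generalizing σ with
  | setNat b i j e => rfl
  | setReal b i j e =>
    have : a ≠ b := by simpa [realWrites] using h
    funext x y
    simp [run, Mem.writeReal, this]
  | seq p q hp hq =>
    simp only [realWrites, List.mem_append, not_or] at h
    rw [run, hq h.2, hp h.1]
  | cond b p hp =>
    rw [run]
    split
    · exact hp h σ
    · rfl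
  | rep c b p hp =>
    rw [run]
    generalize σ.nat 0 0 b = k
    induction k with
    | zero => rfl
    | succ k ih => rw [Function.iterate_succ_apply', ← ih]; exact hp h _

/-- Since array `0` is never written, all loop bounds keep their initial values. Since a body does
not touch its own counter, the while loop makes exactly as many rounds as the iterate in `run`. -/
theorem exec_toCmd (p : Prog) (hp : p.WellFormed) (h0 : 0 ∉ p.natWrites) (x : ℕ) (σ : Mem)
    (hx : ∀ b, σ.nat 0 0 b ≤ x) : ∃ t ≤ p.time.eval x, Exec p.toCmd σ t (p.run σ) := by
  induction p generalizing σ with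
  | setNat a i j e => exact ⟨_, by simp [time], .setNat a i j e σ⟩
  | setReal a i j e => exact ⟨_, by simp [time], .setReal a i j e σ⟩
  | seq p q ihp ihq =>
    simp only [natWrites, List.mem_append, not_or] at h0
    obtain ⟨t, ht, h⟩ := ihp hp.1 h0.1 σ hx
    obtain ⟨u, hu, h'⟩ := ihq hp.2 h0.2 (p.run σ) (by rwa [run_nat_of_notMem _ h0.1])
    exact ⟨_, by simp only [time, Polynomial.eval_add]; omega, .seq h h'⟩
  | cond b p ih =>
    obtain ⟨t, ht, h⟩ := ih hp h0 σ hx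
    rw [run]
    split
    case isTrue hb =>
      exact ⟨_, by simp only [time, Polynomial.eval_add, Polynomial.eval_C]; omega,
        .iteTrue hb h⟩
    case isFalse hb =>
      exact ⟨_, by simp only [time, Polynomial.eval_add, Polynomial.eval_C]; omega,
        .iteFalse hb (.skip σ)⟩
  | rep c b p ih =>
    obtain ⟨hwf, hc⟩ := hp
    simp only [natWrites, List.mem_cons, not_or] at h0
    obtain ⟨hc0, h0⟩ := h0
    -- Induction on the number `k` of remaining rounds. A round costs, besides the body, `9 + 1` for
    -- the test and the loop and `8` for the increment; the final failing test costs `10`.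
    have key : ∀ (k : ℕ) (τ : Mem), τ.nat 0 = σ.nat 0 → τ.nat c 0 0 + k = σ.nat 0 0 b →
        ∃ t ≤ k * (p.time.eval x + 18) + 10,
          Exec (.loop (.natLe (.add (scalar c) (.const 1)) (bound b)) (.seq p.toCmd (incr c))) τ t
          ((fun τ => (p.run τ).writeNat c 0 0 ((p.run τ).nat c 0 0 + 1))^[k] τ) := by
      intro k
      induction k with
      | zero =>
        intro τ hτ hk
        refine ⟨_, ?_, .loopFalse ?_⟩
        · simp [BExp.cost, NExp.cost]
        · simp [BExp.Holds, NExp.eval, hτ]; omega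
      | succ k ihk =>
        intro τ hτ hk
        obtain ⟨t, ht, he⟩ := ih hwf h0 τ (by rw [hτ]; exact hx)
        have hr0 : (p.run τ).nat 0 = σ.nat 0 := by rw [run_nat_of_notMem _ h0, hτ]
        have hrc : (p.run τ).nat c = τ.nat c := run_nat_of_notMem _ hc τ
        obtain ⟨u, hu, hl⟩ := ihk ((p.run τ).writeNat c 0 0 ((p.run τ).nat c 0 0 + 1))
          (by rw [← hr0]; funext y z; simp [Mem.writeNat, hc0])
          (by simp [Mem.writeNat, hrc]; omega)
        refine ⟨_, ?_, .loopTrue ?_ (.seq he (.setNat c _ _ _ _)) hl⟩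
        · simp only [BExp.cost, NExp.cost, Nat.add_mul]; omega
        · simp [BExp.Holds, NExp.eval, hτ]; omega
    obtain ⟨t, ht, he⟩ := key (σ.nat 0 0 b) (σ.writeNat c 0 0 0)
      (by funext y z; simp [Mem.writeNat, hc0]) (by simp [Mem.writeNat])
    refine ⟨_, ?_, .seq (.setNat c _ _ _ σ) he⟩
    have : σ.nat 0 0 b * (p.time.eval x + 18) ≤ x * (p.time.eval x + 18) :=
      Nat.mul_le_mul_right _ (hx b)
    simp only [time, Polynomial.eval_add, Polynomial.eval_mul, Polynomial.eval_X,
      Polynomial.eval_C, NExp.cost]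
    omega

/-- The invariant rule for counted loops. -/
theorem run_rep {c b : ℕ} {p : Prog} {σ : Mem} {n : ℕ} (hn : σ.nat 0 0 b = n)
    (I : ℕ → Mem → Prop) (hc : c ∉ p.natWrites)
    (start : I 0 (σ.writeNat c 0 0 0))
    (step : ∀ k τ, k < n → τ.nat c 0 0 = k → (∀ a ∉ c :: p.natWrites, τ.nat a = σ.nat a) →
      (∀ a ∉ p.realWrites, τ.real a = σ.real a) → I k τ →
      I (k + 1) ((p.run τ).writeNat c 0 0 (k + 1))) :
    I n ((rep c b p).run σ) := by
  rw [run, hn]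
  simp only [List.mem_cons, not_or] at step
  have key : ∀ k ≤ n, ∀ τ,
      τ = (fun τ => (p.run τ).writeNat c 0 0 ((p.run τ).nat c 0 0 + 1))^[k] (σ.writeNat c 0 0 0) →
      τ.nat c 0 0 = k ∧ (∀ a, a ≠ c ∧ a ∉ p.natWrites → τ.nat a = σ.nat a) ∧
        (∀ a ∉ p.realWrites, τ.real a = σ.real a) ∧ I k τ := by
    intro k
    induction k with
    | zero =>
      rintro - τ rfl
      exact ⟨by simp, fun a ha => by simp [ha.1], fun a _ => by simp, start⟩
    | succ k ih =>
      rintro hk τ rfl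
      obtain ⟨h1, h2, h3, h4⟩ := ih (by omega) _ rfl
      rw [Function.iterate_succ_apply']
      generalize (fun τ : Mem =>
        (p.run τ).writeNat c 0 0 ((p.run τ).nat c 0 0 + 1))^[k] (σ.writeNat c 0 0 0) = ρ at *
      have hr : (p.run ρ).nat c 0 0 = k := by rw [run_nat_of_notMem p hc, h1]
      simp only [hr]
      refine ⟨by simp, fun a ha => ?_, fun a ha => ?_, step k _ (by omega) h1 h2 h3 h4⟩
      · rw [Mem.writeNat_nat_of_ne _ ha.1, run_nat_of_notMem p ha.2, h2 a ha]
      · rw [Mem.writeNat_real, run_real_of_notMem p ha, h3 a ha]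
  exact (key _ le_rfl _ rfl).2.2.2

end Prog
end SocialImpact

/-! ### Searching for a maximiser -/

namespace SocialImpact
namespace Prog

/-- The test and the step of the search for a maximiser. -/
def argmaxStep (b : ℕ) (test : BExp) (val : RExp) : Prog :=
  cond (.and test (.not (.and (.natLe (.add (scalar 20) (.const 1)) (bound b))
      (.realLe val (.read 3 (.const 0) (.const 0))))))
    (seq (setNat 20 (.const 0) (.const 0) (scalar 21))
      (setReal 3 (.const 0) (.const 0) val))

/-- The search for a maximiser of `val` among the indices that satisfy `test`. The index runs
through array `21`, and the result is left in array `20`; it is the bound if there is none. -/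
def argmax (b : ℕ) (test : BExp) (val : RExp) : Prog :=
  seq (setNat 20 (.const 0) (.const 0) (bound b)) (rep 21 b (argmaxStep b test val))

@[simp]
theorem natWrites_argmax (b : ℕ) (test : BExp) (val : RExp) :
    (argmax b test val).natWrites = [20, 21, 20] := rfl

@[simp]
theorem realWrites_argmax (b : ℕ) (test : BExp) (val : RExp) :
    (argmax b test val).realWrites = [3] := rfl

@[simp]
theorem wellFormed_argmax (b : ℕ) (test : BExp) (val : RExp) :
    (argmax b test val).WellFormed := by
  simp [argmax, argmaxStep, WellFormed, natWrites]

/-- The memories that differ from `σ` in the working space of the search only. -/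
def SearchFrame (σ τ : Mem) : Prop :=
  (∀ a, a ≠ 20 → a ≠ 21 → τ.nat a = σ.nat a) ∧ ∀ a, a ≠ 3 → τ.real a = σ.real a

/-- The hypotheses quantify over all memories in `SearchFrame σ` because test and value are
evaluated while the search changes its working space: they may depend on the running index, but not
on the result found so far. -/
theorem run_argmax (b : ℕ) (test : BExp) (val : RExp) (σ : Mem) (P : ℕ → Prop) (f : ℕ → ℝ)
    (hP : ∀ τ, SearchFrame σ τ → (test.Holds τ ↔ P (τ.nat 21 0 0)))
    (hf : ∀ τ, SearchFrame σ τ → val.eval τ = f (τ.nat 21 0 0)) {ρ : Mem}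
    (hρ : (argmax b test val).run σ = ρ) :
    SearchFrame σ ρ ∧ ((ρ.nat 20 0 0 = σ.nat 0 0 b ∧ ∀ i < σ.nat 0 0 b, ¬ P i) ∨
      (ρ.nat 20 0 0 < σ.nat 0 0 b ∧ P (ρ.nat 20 0 0) ∧
        ∀ i < σ.nat 0 0 b, P i → f i ≤ f (ρ.nat 20 0 0))) := by
  subst hρ
  refine ⟨⟨fun a h1 h2 => run_nat_of_notMem _ (by simp [h1, h2]) σ,
    fun a h => run_real_of_notMem _ (by simp [h]) σ⟩, ?_⟩
  have key := run_rep (c := 21) (b := b) (p := argmaxStep b test val)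
    (σ := σ.writeNat 20 0 0 (σ.nat 0 0 b))
    (n := σ.nat 0 0 b) (by simp)
    (fun k τ => SearchFrame σ τ ∧
      ((τ.nat 20 0 0 = σ.nat 0 0 b ∧ ∀ i < k, ¬ P i) ∨
      (τ.nat 20 0 0 < σ.nat 0 0 b ∧ P (τ.nat 20 0 0) ∧ τ.real 3 0 0 = f (τ.nat 20 0 0) ∧
        ∀ i < k, P i → f i ≤ f (τ.nat 20 0 0))))
    (by simp [argmaxStep, natWrites])
    (by refine ⟨⟨?_, ?_⟩, ?_⟩ <;> simp +contextual) ?_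
  · obtain ⟨-, h | ⟨h1, h2, -, h3⟩⟩ := key
    · exact Or.inl h
    · exact Or.inr ⟨h1, h2, h3⟩
  · rintro k τ hk hτk - - ⟨hfr, hI⟩
    have hτ0 : τ.nat 0 = σ.nat 0 := hfr.1 0 (by simp) (by simp)
    have hPk := hP τ hfr
    have hfk := hf τ hfr
    rw [hτk] at hPk hfk
    -- The best value is stored after the index has been updated, so `val` is evaluated in the
    -- modified memory.
    have hval : val.eval (τ.writeNat 20 0 0 k) = f k := by
      rw [hf _ ⟨fun a h1 h2 => by simp [h1, hfr.1 a h1 h2], fun a h => by simp [hfr.2 a h]⟩]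
      simp [hτk]
    have htest : (BExp.and test (.not (.and (.natLe (.add (scalar 20) (.const 1)) (bound b))
        (.realLe val (.read 3 (.const 0) (.const 0)))))).Holds τ ↔
        P k ∧ ¬ (τ.nat 20 0 0 + 1 ≤ σ.nat 0 0 b ∧ f k ≤ τ.real 3 0 0) := by
      simp only [BExp.Holds, NExp.eval, RExp.eval, hPk, hfk, hτ0]
    rw [argmaxStep]
    by_cases h : P k ∧ ¬ (τ.nat 20 0 0 + 1 ≤ σ.nat 0 0 b ∧ f k ≤ τ.real 3 0 0)
    · rw [run_cond_of_holds (htest.2 h)]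
      simp only [run_seq, run_setNat, run_setReal, NExp.eval, hτk, hval]
      refine ⟨⟨fun a h1 h2 => by simp [h1, h2, hfr.1], fun a h => by simp [h, hfr.2]⟩, Or.inr ?_⟩
      refine ⟨by simpa using hk, by simpa using h.1, by simp, ?_⟩
      intro i hi hPi
      simp only [Mem.writeNat_nat_of_ne _ (show 20 ≠ 21 by decide), Mem.writeReal_nat,
        Mem.writeNat_nat, and_self, if_true]
      rcases Nat.lt_succ_iff_lt_or_eq.1 hi with hi | rfl
      · rcases hI with hI | hI
        · exact absurd hPi (hI.2 i hi)
        · have := h.2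
          rw [hI.2.2.1] at this
          have h4 := hI.2.2.2 i hi hPi
          by_contra h5
          exact this ⟨by omega, by linarith⟩
      · exact le_rfl
    · rw [run_cond_of_not_holds fun hh => h (htest.1 hh)]
      refine ⟨⟨fun a h1 h2 => by simp [h2, hfr.1, h1], fun a h => by simp [h, hfr.2]⟩, ?_⟩
      simp only [Mem.writeNat_nat_of_ne _ (show 20 ≠ 21 by decide), Mem.writeNat_real]
      rcases hI with hI | hI
      · refine Or.inl ⟨hI.1, fun i hi hPi => ?_⟩
        rcases Nat.lt_succ_iff_lt_or_eq.1 hi with hi | rfl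
        · exact hI.2 i hi hPi
        · exact h ⟨hPi, fun h6 => by omega⟩
      · refine Or.inr ⟨hI.1, hI.2.1, hI.2.2.1, fun i hi hPi => ?_⟩
        rcases Nat.lt_succ_iff_lt_or_eq.1 hi with hi | rfl
        · exact hI.2.2.2 i hi hPi
        · by_contra h5
          exact h ⟨hPi, fun h6 => h5 (by rw [← hI.2.2.1]; exact h6.2)⟩

end Prog
end SocialImpact

namespace SocialImpact

/-! ### Top trading cycles -/

/-- By pigeonhole two of the first `n + 1` iterates coincide; the earlier of them is periodic, and
so are all its successors. Thus a walk of fixed length finds a cycle without any cycle detection. -/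
theorem iterate_mem_periodicPts {α : Type*} [DecidableEq α] {s : Finset α} {f : α → α}
    (hf : ∀ x ∈ s, f x ∈ s) {x : α} (hx : x ∈ s) {n : ℕ} (hn : s.card ≤ n) :
    f^[n] x ∈ Function.periodicPts f := by
  have hmem : ∀ k, f^[k] x ∈ s := by
    intro k
    induction k with
    | zero => exact hx
    | succ k ih => rw [Function.iterate_succ_apply']; exact hf _ ih
  obtain ⟨a, ha, b, hb, hab, he⟩ := Finset.exists_ne_map_eq_of_card_lt_of_maps_to
    (s := Finset.range (n + 1)) (t := s) (f := fun k => f^[k] x) (by simpa using by omega)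
    (fun k _ => hmem k)
  wlog h : a < b generalizing a b
  · exact this b hb a ha hab.symm he.symm (by omega)
  simp only [Finset.mem_range] at ha
  have hper : Function.IsPeriodicPt f (b - a) (f^[a] x) := by
    rw [Function.IsPeriodicPt, Function.IsFixedPt, ← Function.iterate_add_apply,
      Nat.sub_add_cancel h.le]
    exact he.symm
  refine ⟨b - a, by omega, ?_⟩
  have := hper.apply_iterate (n - a)
  rwa [← Function.iterate_add_apply, Nat.sub_add_cancel (by omega)] at this

/-- The state of the trade of bundles after `t` rounds: `V i b` is the value of bundle `b` for
agent `i`, `own₀` and `own` are the initial and the present ownership of bundles, and `rank i` is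
the round in which agent `i` left, or `n` if she is still active. -/
structure TradeState (n t : ℕ) (V : ℕ → ℕ → ℝ) (own₀ own rank : ℕ → ℕ) : Prop where
  own_lt : ∀ i < n, own i < n
  own_inj : ∀ i < n, ∀ j < n, own i = own j → i = j
  improve : ∀ i < n, V i (own₀ i) ≤ V i (own i)
  rank_lt_or_eq : ∀ i < n, rank i < t ∨ rank i = n
  noEnvy : ∀ i < n, ∀ j < n, rank i < t → rank i ≤ rank j → V i (own j) ≤ V i (own i)
  card_le : t ≤ ((Finset.range n).filter (rank · < t)).card

/-- One round of trade: agents on cycles of the map `f` to favourite active agents leave with the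
bundles of their favourites. -/
theorem TradeState.round {n t : ℕ} {V : ℕ → ℕ → ℝ} {own₀ own rank : ℕ → ℕ}
    (h : TradeState n t V own₀ own rank) (ht : t < n) {f own' rank' : ℕ → ℕ}
    (hf : ∀ i < n, t ≤ rank i → f i < n ∧ t ≤ rank (f i) ∧
      ∀ j < n, t ≤ rank j → V i (own j) ≤ V i (own (f i)))
    (hin : ∀ i < n, t ≤ rank i →
      own' (f^[n] i) = own (f (f^[n] i)) ∧ rank' (f^[n] i) = t)
    (hout : ∀ x < n, (¬ ∃ i < n, t ≤ rank i ∧ f^[n] i = x) → own' x = own x ∧ rank' x = rank x) :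
    TradeState n (t + 1) V own₀ own' rank' := by
  classical
  set S := (Finset.range n).filter (t ≤ rank ·) with hS
  have memS : ∀ {i}, i ∈ S ↔ i < n ∧ t ≤ rank i := by simp [hS]
  have fS : ∀ i ∈ S, f i ∈ S := fun i hi => by
    rw [memS] at hi ⊢
    exact ⟨(hf i hi.1 hi.2).1, (hf i hi.1 hi.2).2.1⟩
  have itS : ∀ k, ∀ i ∈ S, f^[k] i ∈ S := by
    intro k
    induction k with
    | zero => exact fun i hi => hi
    | succ k ih => exact fun i hi => by rw [Function.iterate_succ_apply']; exact fS _ (ih i hi)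
  set C := S.image f^[n] with hC
  have CS : ∀ x ∈ C, x ∈ S := by
    intro x hx
    obtain ⟨i, hi, rfl⟩ := Finset.mem_image.1 hx
    exact itS n i hi
  -- As `f` commutes with `f^[n]`, the image `C` is invariant under `f`.
  have fC : ∀ x ∈ C, f x ∈ C := by
    intro x hx
    obtain ⟨i, hi, rfl⟩ := Finset.mem_image.1 hx
    rw [← Function.iterate_succ_apply' f, Function.iterate_succ_apply]
    exact Finset.mem_image_of_mem _ (fS i hi)
  have perC : ∀ x ∈ C, x ∈ Function.periodicPts f := by
    intro x hx
    obtain ⟨i, hi, rfl⟩ := Finset.mem_image.1 hx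
    exact iterate_mem_periodicPts fS hi ((Finset.card_filter_le _ _).trans (by simp))
  -- A map is injective on its periodic points, so no bundle is handed to two agents.
  have injC : ∀ x ∈ C, ∀ y ∈ C, f x = f y → x = y := fun x hx y hy hxy =>
    (Function.bijOn_periodicPts f).injOn (perC x hx) (perC y hy) hxy
  have inC : ∀ x ∈ C, own' x = own (f x) ∧ rank' x = t := by
    intro x hx
    obtain ⟨i, hi, rfl⟩ := Finset.mem_image.1 hx
    rw [memS] at hi
    exact hin i hi.1 hi.2
  have outC : ∀ x < n, x ∉ C → own' x = own x ∧ rank' x = rank x := by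
    intro x hxn hx
    refine hout x hxn fun ⟨i, hi, hti, hix⟩ => hx ?_
    exact Finset.mem_image.2 ⟨i, memS.2 ⟨hi, hti⟩, hix⟩
  have rankS : ∀ x ∈ S, rank x = n := fun x hx => by
    have h1 := memS.1 hx
    rcases h.rank_lt_or_eq x h1.1 with h2 | h2
    · omega
    · exact h2
  -- Bundles of active agents go to active agents only. Hence comparisons with all agents active at
  -- the start of the round, old and new, survive the trade.
  have ownS : ∀ x ∈ S, ∃ y ∈ S, own' x = own y := by
    intro x hx
    by_cases hxC : x ∈ C
    · exact ⟨f x, fS x hx, (inC x hxC).1⟩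
    · exact ⟨x, hx, (outC x (memS.1 hx).1 hxC).1⟩
  have notS : ∀ x < n, x ∉ S → own' x = own x ∧ rank' x = rank x ∧ rank x < t := by
    intro x hx hxS
    have := outC x hx fun hh => hxS (CS x hh)
    refine ⟨this.1, this.2, ?_⟩
    by_contra hlt
    exact hxS (memS.2 ⟨hx, by omega⟩)
  refine ⟨?_, ?_, ?_, ?_, ?_, ?_⟩
  · intro i hi
    by_cases hiC : i ∈ C
    · rw [(inC i hiC).1]
      exact h.own_lt _ (memS.1 (CS _ (fC i hiC))).1
    · rw [(outC i hi hiC).1]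
      exact h.own_lt i hi
  · intro i hi j hj hij
    by_cases hiC : i ∈ C <;> by_cases hjC : j ∈ C
    · rw [(inC i hiC).1, (inC j hjC).1] at hij
      exact injC i hiC j hjC (h.own_inj _ (memS.1 (CS _ (fC i hiC))).1 _
        (memS.1 (CS _ (fC j hjC))).1 hij)
    · rw [(inC i hiC).1, (outC j hj hjC).1] at hij
      have := h.own_inj _ (memS.1 (CS _ (fC i hiC))).1 _ hj hij
      exact absurd (this ▸ fC i hiC) hjC
    · rw [(inC j hjC).1, (outC i hi hiC).1] at hij
      have := h.own_inj _ hi _ (memS.1 (CS _ (fC j hjC))).1 hij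
      exact absurd (this ▸ fC j hjC) hiC
    · rw [(outC i hi hiC).1, (outC j hj hjC).1] at hij
      exact h.own_inj i hi j hj hij
  · intro i hi
    by_cases hiC : i ∈ C
    · rw [(inC i hiC).1]
      have hiS := memS.1 (CS i hiC)
      exact (h.improve i hi).trans ((hf i hi hiS.2).2.2 i hi hiS.2)
    · rw [(outC i hi hiC).1]
      exact h.improve i hi
  · intro i hi
    by_cases hiC : i ∈ C
    · exact Or.inl (by rw [(inC i hiC).2]; omega)
    · rw [(outC i hi hiC).2]
      rcases h.rank_lt_or_eq i hi with h1 | h1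
      · exact Or.inl (by omega)
      · exact Or.inr h1
  · intro i hi j hj hri hrij
    by_cases hiC : i ∈ C
    · have hiS := memS.1 (CS i hiC)
      have hjS : j ∈ S := by
        by_contra hjS
        obtain ⟨-, h2, h3⟩ := notS j hj hjS
        rw [(inC i hiC).2] at hrij
        omega
      obtain ⟨y, hyS, hy⟩ := ownS j hjS
      rw [(inC i hiC).1, hy]
      exact (hf i hi hiS.2).2.2 y (memS.1 hyS).1 (memS.1 hyS).2
    · obtain ⟨h1, h2⟩ := outC i hi hiC
      rw [h2] at hri hrij
      have hri' : rank i < t := by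
        rcases h.rank_lt_or_eq i hi with h3 | h3
        · exact h3
        · omega
      rw [h1]
      by_cases hjS : j ∈ S
      · obtain ⟨y, hyS, hy⟩ := ownS j hjS
        rw [hy]
        exact h.noEnvy i hi y (memS.1 hyS).1 hri' (by have := (memS.1 hyS).2; omega)
      · obtain ⟨h4, h5, h6⟩ := notS j hj hjS
        rw [h4]
        exact h.noEnvy i hi j hj hri' (by omega)
  -- If someone is active, the walk from there ends at an agent who leaves now. Otherwise all `n >
  -- t` agents have already left.
  · by_cases hSe : S.Nonempty
    · obtain ⟨i, hi⟩ := hSe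
      have hxC : f^[n] i ∈ C := Finset.mem_image_of_mem _ hi
      refine (Nat.succ_le_succ h.card_le).trans ?_
      rw [Nat.succ_eq_add_one, ← Finset.card_insert_of_notMem (a := f^[n] i)]
      · refine Finset.card_le_card fun y hy => ?_
        rcases Finset.mem_insert.1 hy with rfl | hy
        · simp only [Finset.mem_filter, Finset.mem_range]
          exact ⟨(memS.1 (CS _ hxC)).1, by rw [(inC _ hxC).2]; omega⟩
        · simp only [Finset.mem_filter, Finset.mem_range] at hy ⊢
          refine ⟨hy.1, ?_⟩
          rw [(notS y hy.1 fun hh => by have := (memS.1 hh).2; omega).2.1]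
          omega
      · intro hh
        have h1 := (Finset.mem_filter.1 hh).2
        have h2 := (memS.1 (CS _ hxC)).2
        omega
    · rw [Finset.not_nonempty_iff_eq_empty] at hSe
      rw [Finset.filter_true_of_mem]
      · simpa using ht
      · intro x hx
        have := notS x (Finset.mem_range.1 hx) (by simp [hSe])
        omega

/-- The outcome of the trade: every agent has improved, and nobody envies those who left in the
same round or later. -/
structure Traded (n : ℕ) (V : ℕ → ℕ → ℝ) (own₀ own rank : ℕ → ℕ) : Prop where
  own_lt : ∀ i < n, own i < n
  own_inj : ∀ i < n, ∀ j < n, own i = own j → i = j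
  improve : ∀ i < n, V i (own₀ i) ≤ V i (own i)
  rank_lt : ∀ i < n, rank i < n
  noEnvy : ∀ i < n, ∀ j < n, rank i ≤ rank j → V i (own j) ≤ V i (own i)

/-- At least `t` agents have left after `t` rounds, so `n` rounds empty the market. -/
theorem TradeState.traded {n : ℕ} {V : ℕ → ℕ → ℝ} {own₀ own rank : ℕ → ℕ}
    (h : TradeState n n V own₀ own rank) : Traded n V own₀ own rank := by
  have hr : ∀ i < n, rank i < n := by
    have h1 : (Finset.range n).filter (rank · < n) = Finset.range n :=
      Finset.eq_of_subset_of_card_le (Finset.filter_subset _ _) (by simpa using h.card_le)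
    intro i hi
    have : i ∈ (Finset.range n).filter (rank · < n) := by rw [h1]; simpa using hi
    exact (Finset.mem_filter.1 this).2
  exact ⟨h.own_lt, h.own_inj, h.improve, hr, fun i hi j hj => h.noEnvy i hi j hj (hr i hi)⟩

end SocialImpact

namespace SocialImpact
namespace Prog

/-! ### The program

Arrays of naturals: `1` owner and finally recipient of a good, `4` bundle of an agent, `5` bundle of
a good, `6` state of a good (`0` free, `1` in the current block, `2` allocated), `7` round in which
an agent left the trade, `8` favourite of an agent, `9` bundle after the round of trade, `2` walk.
Arrays of reals: `2` value of a bundle for an agent. -/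

/-- The value of the bundle of agent `j` for agent `i`. -/
abbrev bundleRead (i j : NExp) : RExp := .read 2 i (entry 4 j)

def favourites : Prog :=
  rep 11 0 (cond (.natLe (scalar 10) (entry 7 (scalar 11)))
    (seq (argmax 0 (.natLe (scalar 10) (entry 7 (scalar 21))) (bundleRead (scalar 11) (scalar 21)))
      (setNat 8 (.const 0) (scalar 11) (scalar 20))))

/-- The inner loop follows favourites for `n` steps, which ends on a cycle. The agent reached there
leaves, not the one from whom the walk starts. -/
def leave : Prog :=
  rep 11 0 (cond (.natLe (scalar 10) (entry 7 (scalar 11)))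
    (seq (setNat 2 (.const 0) (.const 0) (scalar 11))
    (seq (rep 12 0 (setNat 2 (.const 0) (.const 0) (entry 8 (scalar 2))))
    (seq (setNat 9 (.const 0) (scalar 2) (entry 4 (entry 8 (scalar 2))))
      (setNat 7 (.const 0) (scalar 2) (scalar 10))))))

/-- A separate pass: `leave` still has to read the old bundles of favourites in array `4`, so the
new ones wait in array `9`. Rank equal to the current round identifies the agents who have just
left. -/
def exchange : Prog :=
  rep 11 0 (cond (.and (.natLe (scalar 10) (entry 7 (scalar 11)))
      (.natLe (entry 7 (scalar 11)) (scalar 10)))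
    (setNat 4 (.const 0) (scalar 11) (entry 9 (scalar 11))))

def trade : Prog :=
  seq (rep 11 0 (setNat 7 (.const 0) (scalar 11) (bound 0)))
    (rep 10 0 (seq favourites (seq leave exchange)))

theorem run_favourites {σ : Mem} {n t : ℕ} (hn : σ.nat 0 0 0 = n) (ht : σ.nat 10 0 0 = t) :
    ∀ i < n, t ≤ σ.nat 7 0 i →
      (favourites.run σ).nat 8 0 i < n ∧ t ≤ σ.nat 7 0 ((favourites.run σ).nat 8 0 i) ∧
      ∀ j < n, t ≤ σ.nat 7 0 j → σ.real 2 i (σ.nat 4 0 j) ≤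
        σ.real 2 i (σ.nat 4 0 ((favourites.run σ).nat 8 0 i)) := by
  refine run_rep hn (fun k τ => ∀ i < k, t ≤ σ.nat 7 0 i →
      τ.nat 8 0 i < n ∧ t ≤ σ.nat 7 0 (τ.nat 8 0 i) ∧
      ∀ j < n, t ≤ σ.nat 7 0 j → σ.real 2 i (σ.nat 4 0 j) ≤
        σ.real 2 i (σ.nat 4 0 (τ.nat 8 0 i))) (by decide) (by simp) ?_
  intro k τ hk hτk hfn hfr hI i hi hti
  have f0 : τ.nat 0 = σ.nat 0 := hfn 0 (by decide)
  have f7 : τ.nat 7 = σ.nat 7 := hfn 7 (by decide)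
  have f4 : τ.nat 4 = σ.nat 4 := hfn 4 (by decide)
  have f10 : τ.nat 10 = σ.nat 10 := hfn 10 (by decide)
  have r2 : τ.real 2 = σ.real 2 := hfr 2 (by decide)
  by_cases htest : t ≤ σ.nat 7 0 k
  · rw [run_cond_of_holds (by simpa [BExp.Holds, NExp.eval, f10, f7, hτk, ht] using htest),
      run_seq]
    generalize hρ : Prog.run (argmax _ _ _) τ = ρ
    obtain ⟨hsf, ha⟩ := run_argmax _ _ _ τ (fun j => t ≤ σ.nat 7 0 j)
      (fun j => σ.real 2 k (σ.nat 4 0 j))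
      (fun ρ hρ => by simp [BExp.Holds, NExp.eval, hρ.1, f10, f7, ht])
      (fun ρ hρ => by simp [RExp.eval, NExp.eval, hρ.1, hρ.2, r2, f4, hτk]) hρ
    simp only [run_setNat, NExp.eval, hsf.1 11 (by decide) (by decide), hτk]
    rw [Mem.writeNat_nat_of_ne _ (by decide), Mem.writeNat_nat, hsf.1 8 (by decide) (by decide)]
    rw [f0, hn] at ha
    by_cases hik : i = k
    · subst hik
      simp only [and_self, if_true]
      rcases ha with ⟨-, ha⟩ | ⟨h1, h2, h3⟩
      · exact absurd htest (ha i hk)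
      · exact ⟨h1, h2, h3⟩
    · simp only [hik, and_false, if_false]
      exact hI i (by omega) hti
  · rw [run_cond_of_not_holds (by simpa [BExp.Holds, NExp.eval, f10, f7, hτk, ht] using htest),
      Mem.writeNat_nat_of_ne _ (by decide)]
    have : i ≠ k := by rintro rfl; exact htest hti
    exact hI i (by omega) hti

theorem run_walk {σ : Mem} {n : ℕ} (hn : σ.nat 0 0 0 = n) :
    ((rep 12 0 (setNat 2 (.const 0) (.const 0) (entry 8 (scalar 2)))).run σ).nat 2 0 0 =
      (σ.nat 8 0)^[n] (σ.nat 2 0 0) := by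
  refine run_rep hn (fun k τ => τ.nat 2 0 0 = (σ.nat 8 0)^[k] (σ.nat 2 0 0)) (by decide)
    (by simp) ?_
  intro k τ hk hτk hfn hfr hI
  have f8 : τ.nat 8 = σ.nat 8 := hfn 8 (by decide)
  simp [run_setNat, NExp.eval, Function.iterate_succ_apply', hI, f8]

/-- Several walks may end at the same agent, but the values written there depend on that agent and
the round only. -/
theorem run_leave {σ : Mem} {n t : ℕ} (hn : σ.nat 0 0 0 = n) (ht : σ.nat 10 0 0 = t)
    (hf : ∀ i < n, t ≤ σ.nat 7 0 i → σ.nat 8 0 i < n ∧ t ≤ σ.nat 7 0 (σ.nat 8 0 i)) :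
    (∀ i < n, t ≤ σ.nat 7 0 i →
      (leave.run σ).nat 9 0 ((σ.nat 8 0)^[n] i) = σ.nat 4 0 (σ.nat 8 0 ((σ.nat 8 0)^[n] i)) ∧
      (leave.run σ).nat 7 0 ((σ.nat 8 0)^[n] i) = t) ∧
    ∀ x, (¬ ∃ i < n, t ≤ σ.nat 7 0 i ∧ (σ.nat 8 0)^[n] i = x) →
      (leave.run σ).nat 7 0 x = σ.nat 7 0 x := by
  refine run_rep hn (fun k τ => (∀ i < k, t ≤ σ.nat 7 0 i →
      τ.nat 9 0 ((σ.nat 8 0)^[n] i) = σ.nat 4 0 (σ.nat 8 0 ((σ.nat 8 0)^[n] i)) ∧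
      τ.nat 7 0 ((σ.nat 8 0)^[n] i) = t) ∧
    ∀ x, (¬ ∃ i < k, t ≤ σ.nat 7 0 i ∧ (σ.nat 8 0)^[n] i = x) →
      τ.nat 7 0 x = σ.nat 7 0 x) (by decide) (by simp) ?_
  intro k τ hk hτk hfn hfr hI
  have f0 : τ.nat 0 = σ.nat 0 := hfn 0 (by decide)
  have f4 : τ.nat 4 = σ.nat 4 := hfn 4 (by decide)
  have f8 : τ.nat 8 = σ.nat 8 := hfn 8 (by decide)
  have f10 : τ.nat 10 = σ.nat 10 := hfn 10 (by decide)
  have hact : ∀ m, ∀ i < n, t ≤ σ.nat 7 0 i → t ≤ σ.nat 7 0 ((σ.nat 8 0)^[m] i) := by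
    intro m
    induction m with
    | zero => exact fun i _ h => h
    | succ m ih => exact fun i hi h => ih _ (hf i hi h).1 (hf i hi h).2
  -- Ranks are overwritten during the loop, but only those of active agents and only by `t`, so the
  -- test `t ≤ rank` is unaffected.
  have h7 : t ≤ τ.nat 7 0 k ↔ t ≤ σ.nat 7 0 k := by
    by_cases hx : ∃ i < k, t ≤ σ.nat 7 0 i ∧ (σ.nat 8 0)^[n] i = k
    · obtain ⟨i, hi, hti, hik⟩ := hx
      have h1 := (hI.1 i hi hti).2
      have h2 := hact n i (by omega) hti
      rw [hik] at h1 h2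
      rw [h1]
      exact iff_of_true le_rfl h2
    · rw [hI.2 k hx]
  by_cases htest : t ≤ σ.nat 7 0 k
  · rw [run_cond_of_holds (by simpa [BExp.Holds, NExp.eval, f10, hτk, ht, h7] using htest)]
    simp only [run_seq, run_setNat, NExp.eval, hτk]
    set ρ := (rep 12 0 (setNat 2 (.const 0) (.const 0) (entry 8 (scalar 2)))).run
      (τ.writeNat 2 0 0 k) with hρ
    have g2 : ρ.nat 2 0 0 = (σ.nat 8 0)^[n] k := by
      rw [hρ, run_walk (by simpa [f0] using hn)]
      simp [f8]
    have g : ∀ a, a ≠ 2 → a ≠ 12 → ρ.nat a = τ.nat a := by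
      intro a h2 h12
      rw [hρ, run_nat_of_notMem _ (by simp [natWrites, h2, h12]), Mem.writeNat_nat_of_ne _ h2]
    refine ⟨?_, ?_⟩
    · intro i hi hti
      simp only [Mem.writeNat_nat, ne_eq, Nat.reduceEqDiff,
        not_false_eq_true, Mem.writeNat_nat_of_ne, g2, g, f8, f4, f10, ht, true_and]
      split
      case isTrue h => simp [h]
      case isFalse h =>
        have : i ≠ k := by rintro rfl; exact h rfl
        exact hI.1 i (by omega) hti
    · intro x hx
      simp only [Mem.writeNat_nat, ne_eq, Nat.reduceEqDiff,
        not_false_eq_true, Mem.writeNat_nat_of_ne, g2, g, f8, f4, f10, ht, true_and]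
      rw [if_neg fun h => hx ⟨k, by omega, htest, h.symm⟩]
      exact hI.2 x fun ⟨i, hi, h⟩ => hx ⟨i, by omega, h⟩
  · rw [run_cond_of_not_holds (by simpa [BExp.Holds, NExp.eval, f10, hτk, ht, h7] using htest)]
    refine ⟨?_, ?_⟩
    · intro i hi hti
      have : i ≠ k := by rintro rfl; exact htest hti
      simpa using hI.1 i (by omega) hti
    · intro x hx
      simpa using hI.2 x fun ⟨i, hi, h⟩ => hx ⟨i, by omega, h⟩

theorem run_exchange {σ : Mem} {n t : ℕ} (hn : σ.nat 0 0 0 = n) (ht : σ.nat 10 0 0 = t) :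
    ∀ i < n, (exchange.run σ).nat 4 0 i =
      if σ.nat 7 0 i = t then σ.nat 9 0 i else σ.nat 4 0 i := by
  have key := run_rep hn (p := cond (.and (.natLe (scalar 10) (entry 7 (scalar 11)))
      (.natLe (entry 7 (scalar 11)) (scalar 10)))
      (setNat 4 (.const 0) (scalar 11) (entry 9 (scalar 11)))) (c := 11)
    (fun k τ => ∀ i, τ.nat 4 0 i =
      if i < k ∧ σ.nat 7 0 i = t then σ.nat 9 0 i else σ.nat 4 0 i) (by decide) (by simp) ?_
  · intro i hi
    exact (key i).trans (by simp [hi])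
  intro k τ hk hτk hfn hfr hI i
  have f7 : τ.nat 7 = σ.nat 7 := hfn 7 (by decide)
  have f9 : τ.nat 9 = σ.nat 9 := hfn 9 (by decide)
  have f10 : τ.nat 10 = σ.nat 10 := hfn 10 (by decide)
  rw [Mem.writeNat_nat_of_ne _ (by decide)]
  by_cases htest : σ.nat 7 0 k = t
  · rw [run_cond_of_holds (by simpa [BExp.Holds, NExp.eval, f10, f7, hτk, ht] using
      ⟨htest.ge, htest.le⟩)]
    simp only [run_setNat, NExp.eval, hτk, f9, Mem.writeNat_nat, true_and, hI]
    by_cases hik : i = k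
    · subst hik; simp [htest]
    · have : i < k + 1 ↔ i < k := by omega
      simp [hik, this]
  · rw [run_cond_of_not_holds (by
      simp only [BExp.Holds, NExp.eval, f10, f7, hτk, ht]; omega), hI]
    by_cases hik : i = k
    · subst hik; simp [htest]
    · have : i < k + 1 ↔ i < k := by omega
      simp [this]

theorem run_trade {σ : Mem} {n : ℕ} (hn : σ.nat 0 0 0 = n)
    (hlt : ∀ i < n, σ.nat 4 0 i < n)
    (hinj : ∀ i < n, ∀ j < n, σ.nat 4 0 i = σ.nat 4 0 j → i = j) :
    Traded n (σ.real 2) (σ.nat 4 0) ((trade.run σ).nat 4 0) ((trade.run σ).nat 7 0) := by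
  apply TradeState.traded
  rw [trade, run_seq]
  have hstart := run_rep hn (p := setNat 7 (.const 0) (scalar 11) (bound 0)) (c := 11)
    (fun k τ => ∀ i < k, τ.nat 7 0 i = n) (by decide) (by simp) (by
      intro k τ hk hτk hfn hfr hI i hi
      have f0 : τ.nat 0 = σ.nat 0 := hfn 0 (by decide)
      simp only [run_setNat, NExp.eval, hτk, f0, hn, ne_eq,
        Nat.reduceEqDiff, not_false_eq_true, Mem.writeNat_nat_of_ne, Mem.writeNat_nat, true_and]
      split
      · rfl
      · exact hI i (by omega))
  set ρ := (rep 11 0 (setNat 7 (.const 0) (scalar 11) (bound 0))).run σ with hρ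
  have g0 : ρ.nat 0 = σ.nat 0 := run_nat_of_notMem _ (by decide) _
  have g4 : ρ.nat 4 = σ.nat 4 := run_nat_of_notMem _ (by decide) _
  have s2 : ρ.real 2 = σ.real 2 := run_real_of_notMem _ (by decide) _
  refine run_rep (n := n) (by rw [g0, hn]) (fun t τ =>
    TradeState n t (σ.real 2) (σ.nat 4 0) (τ.nat 4 0) (τ.nat 7 0)) (by decide) ?_ ?_
  · simp only [ne_eq,
        Nat.reduceEqDiff, not_false_eq_true, Mem.writeNat_nat_of_ne, g4]
    exact ⟨hlt, hinj, fun _ _ => le_rfl, fun i hi => Or.inr (hstart i hi), by simp, by simp⟩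
  · intro t τ ht hτt hfn hfr hI
    have f0 : τ.nat 0 0 0 = n := by rw [hfn 0 (by decide), g0, hn]
    have r2 : τ.real 2 = σ.real 2 := (hfr 2 (by decide)).trans s2
    simp only [run_seq, ne_eq,
        Nat.reduceEqDiff, not_false_eq_true, Mem.writeNat_nat_of_ne]
    have hA := run_favourites f0 hτt
    set A := favourites.run τ
    have A0 : A.nat 0 = τ.nat 0 := run_nat_of_notMem _ (by decide) _
    have A4 : A.nat 4 = τ.nat 4 := run_nat_of_notMem _ (by decide) _
    have A7 : A.nat 7 = τ.nat 7 := run_nat_of_notMem _ (by decide) _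
    have A10 : A.nat 10 = τ.nat 10 := run_nat_of_notMem _ (by decide) _
    have hB := run_leave (σ := A) (n := n) (t := t) (by rw [A0, f0]) (by rw [A10, hτt])
      (by rw [A7]; exact fun i hi hti => ⟨(hA i hi hti).1, (hA i hi hti).2.1⟩)
    set B := leave.run A
    have B0 : B.nat 0 = A.nat 0 := run_nat_of_notMem _ (by decide) _
    have B4 : B.nat 4 = A.nat 4 := run_nat_of_notMem _ (by decide) _
    have B10 : B.nat 10 = A.nat 10 := run_nat_of_notMem _ (by decide) _
    have hC := run_exchange (σ := B) (n := n) (t := t) (by rw [B0, A0, f0]) (by rw [B10, A10, hτt])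
    set C := exchange.run B
    have C7 : C.nat 7 = B.nat 7 := run_nat_of_notMem _ (by decide) _
    rw [r2] at hA
    rw [A7, A4] at hB
    have hmem : ∀ m, ∀ i < n, t ≤ τ.nat 7 0 i → (A.nat 8 0)^[m] i < n := by
      intro m
      induction m with
      | zero => exact fun i h _ => h
      | succ m ih => exact fun i hi h => ih _ (hA i hi h).1 (hA i hi h).2.1
    refine hI.round ht hA ?_ ?_
    · intro i hi hti
      obtain ⟨h1, h2⟩ := hB.1 i hi hti
      rw [C7]
      refine ⟨?_, h2⟩
      rw [hC _ (hmem n i hi hti), if_pos h2, h1]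
    · intro x hx hne
      have h2 := hB.2 x hne
      rw [C7]
      refine ⟨?_, h2⟩
      rw [hC x hx, if_neg, B4, A4]
      rw [h2]
      rcases hI.rank_lt_or_eq x hx with h3 | h3 <;> omega

end Prog
end SocialImpact

namespace SocialImpact

/-! ### Bundles and envy -/

/-- The goods below `m` with label `b`. -/
def labelled (m : ℕ) (lab : ℕ → ℕ) (b : ℕ) : Finset ℕ := (Finset.range m).filter (lab · = b)

theorem mem_labelled {m : ℕ} {lab : ℕ → ℕ} {b g : ℕ} : g ∈ labelled m lab b ↔ g < m ∧ lab g = b := by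
  simp [labelled]

/-- With valuation `f` and bundle `A`, there is no envy towards `B` up to one good. -/
def EnvyFreeUpToOne (f : ℕ → ℝ) (A B : Finset ℕ) : Prop :=
  ∃ R ⊆ B, R.card ≤ 1 ∧ ∑ g ∈ B \ R, f g ≤ ∑ g ∈ A, f g

/-- The situation between two blocks: no good is in a block (`st g = 1`), free goods (`st g = 0`)
and permanently allocated goods have label `n`, `V` holds the values of the bundles, and the
ownership of bundles is envy-free up to one good. -/
structure FairState (n m : ℕ) (v : ℕ → ℕ → ℝ) (own st lab : ℕ → ℕ) (V : ℕ → ℕ → ℝ) : Prop where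
  own_lt : ∀ i < n, own i < n
  own_inj : ∀ i < n, ∀ j < n, own i = own j → i = j
  value : ∀ i < n, ∀ b < n, V i b = ∑ g ∈ labelled m lab b, v i g
  ef : ∀ i < n, ∀ j < n,
    EnvyFreeUpToOne (v i) (labelled m lab (own i)) (labelled m lab (own j))
  status : ∀ g < m, (st g = 0 ∧ lab g = n) ∨ (st g = 2 ∧ lab g ≤ n)

/-- An injective self-map of a finite set is surjective: every bundle has an owner. -/
theorem exists_eq_of_injective_lt {n : ℕ} {own : ℕ → ℕ} (hlt : ∀ i < n, own i < n)
    (hinj : ∀ i < n, ∀ j < n, own i = own j → i = j) {b : ℕ} (hb : b < n) :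
    ∃ i < n, own i = b := by
  obtain ⟨i, hi, h⟩ := Finset.surjOn_of_injOn_of_card_le (s := Finset.range n)
    (t := Finset.range n) own (fun i hi => by simpa using hlt i (by simpa using hi))
    (fun i hi j hj h => hinj i (by simpa using hi) j (by simpa using hj) h) le_rfl
    (show b ∈ ((Finset.range n : Finset ℕ) : Set ℕ) by simpa using hb)
  exact ⟨i, by simpa using hi, h⟩

/-- The situation while the agents pick goods from a block: `D` is the set of agents who have
picked, and `st₀`, `lab₀` describe the situation before the first pick. -/
structure PickState (n m : ℕ) (v : ℕ → ℕ → ℝ) (own rank st₀ lab₀ : ℕ → ℕ) (D : Finset ℕ)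
    (st lab : ℕ → ℕ) (V : ℕ → ℕ → ℝ) : Prop where
  value : ∀ i < n, ∀ b < n, V i b = ∑ g ∈ labelled m lab b, v i g
  ef : ∀ i < n, ∀ j < n,
    EnvyFreeUpToOne (v i) (labelled m lab (own i)) (labelled m lab (own j))
  -- The reserve of an agent who has picked: envy-freeness up to one good would survive the addition
  -- of any remaining good to the bundle of an agent who has not.
  surplus : ∀ i < n, ∀ j < n, i ∈ D → j ∉ D → ∀ g < m, st g = 1 →
    ∃ R ⊆ labelled m lab (own j), R.card ≤ 1 ∧
      ∑ h ∈ labelled m lab (own j) \ R, v i h + v i g ≤ ∑ h ∈ labelled m lab (own i), v i h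
  noEnvy : ∀ i < n, ∀ j < n, i ∉ D → j ∉ D → rank i ≤ rank j →
    ∑ h ∈ labelled m lab (own j), v i h ≤ ∑ h ∈ labelled m lab (own i), v i h
  card_block : (labelled m st 1).card = (labelled m st₀ 1).card - D.card
  other : ∀ g, st₀ g ≠ 1 → st g = st₀ g ∧ lab g = lab₀ g
  block : ∀ g < m, st₀ g = 1 → (st g = 1 ∧ lab g = n) ∨ (st g = 2 ∧ lab g < n)
  -- Only a full block guarantees a good for every bundle.
  gain : ∀ u ∈ D, (labelled m st₀ 1).card = n → ∃ g < m, st₀ g = 1 ∧ lab g = own u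

/-! ### Picking from a block, those who left the trade last first -/

section Pick

variable {n m : ℕ} {v : ℕ → ℕ → ℝ} {own rank st₀ lab₀ : ℕ → ℕ} {D : Finset ℕ}
  {st lab : ℕ → ℕ} {V : ℕ → ℕ → ℝ}

/-- An empty block before the last pick means that it had fewer than `n` goods, so `gain` holds
vacuously, as does `surplus`. -/
theorem PickState.skip (h : PickState n m v own rank st₀ lab₀ D st lab V) {u : ℕ} (hu : u < n)
    (hD : D ⊆ Finset.range n) (huD : u ∉ D) (hempty : ∀ g < m, st g ≠ 1) :
    PickState n m v own rank st₀ lab₀ (insert u D) st lab V := by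
  have h0 : (labelled m st 1).card = 0 := by
    rw [Finset.card_eq_zero, Finset.eq_empty_iff_forall_notMem]
    exact fun g hg => hempty g (mem_labelled.1 hg).1 (mem_labelled.1 hg).2
  have hlt : D.card < n := by
    have := Finset.card_le_card (Finset.insert_subset (Finset.mem_range.2 hu) hD)
    rw [Finset.card_insert_of_notMem huD, Finset.card_range] at this
    omega
  have hcb := h.card_block
  refine ⟨h.value, h.ef, ?_, ?_, ?_, h.other, h.block, ?_⟩
  · intro i hi j hj _ _ g hg hst
    exact absurd hst (hempty g hg)
  · intro i hi j hj hiD hjD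
    exact h.noEnvy i hi j hj (fun hh => hiD (Finset.mem_insert_of_mem hh))
      (fun hh => hjD (Finset.mem_insert_of_mem hh))
  · rw [Finset.card_insert_of_notMem huD]
    omega
  · intro _ _ hn
    omega

/-- Envy towards the picker `u` is controlled by `surplus` for those who have picked and by `noEnvy`
for those who have not, the latter because `u` has the largest rank among them. -/
theorem PickState.pick (h : PickState n m v own rank st₀ lab₀ D st lab V)
    (hv : ∀ i g, 0 ≤ v i g) (hlt : ∀ i < n, own i < n)
    (hinj : ∀ i < n, ∀ j < n, own i = own j → i = j) {u : ℕ} (hu : u < n) (hD : D ⊆ Finset.range n)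
    (huD : u ∉ D) (hrank : ∀ k < n, k ∉ D → rank k ≤ rank u) {x : ℕ} (hx : x < m) (hstx : st x = 1)
    (hmax : ∀ g < m, st g = 1 → v u g ≤ v u x) {st' lab' : ℕ → ℕ} {V' : ℕ → ℕ → ℝ}
    (hst' : ∀ g, st' g = if g = x then 2 else st g)
    (hlab' : ∀ g, lab' g = if g = x then own u else lab g)
    (hV' : ∀ k < n, ∀ b, V' k b = if b = own u then V k b + v k x else V k b) :
    PickState n m v own rank st₀ lab₀ (insert u D) st' lab' V' := by
  have hst0 : st₀ x = 1 := by
    by_contra hne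
    have := (h.other x hne).1
    omega
  have hlabx : lab x = n := by
    rcases h.block x hx hst0 with hh | hh <;> omega
  have hown : own u < n := hlt u hu
  have hlu : labelled m lab' (own u) = insert x (labelled m lab (own u)) := by
    ext g
    simp only [mem_labelled, Finset.mem_insert, hlab']
    split
    case isTrue hg => subst hg; simp [hx]
    case isFalse hg => simp [hg]
  have hxu : x ∉ labelled m lab (own u) := fun hh => by
    have := (mem_labelled.1 hh).2
    omega
  have hlb : ∀ b < n, b ≠ own u → labelled m lab' b = labelled m lab b := by
    intro b hb hne
    ext g
    simp only [mem_labelled, hlab']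
    split
    case isTrue hg => subst hg; simp [hne.symm]; omega
    case isFalse hg => rfl
  have hlj : ∀ j < n, j ≠ u → labelled m lab' (own j) = labelled m lab (own j) := fun j hj hne =>
    hlb _ (hlt j hj) fun hh => hne (hinj j hj u hu hh)
  have hsu : ∀ f : ℕ → ℝ, ∑ g ∈ labelled m lab' (own u), f g =
      f x + ∑ g ∈ labelled m lab (own u), f g := fun f => by
    rw [hlu, Finset.sum_insert hxu]
  have hmono : ∀ i < n, ∀ j, ∑ g ∈ labelled m lab (own i), v j g ≤
      ∑ g ∈ labelled m lab' (own i), v j g := by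
    intro i hi j
    by_cases hiu : i = u
    · subst hiu; rw [hsu]; linarith [hv j x]
    · rw [hlj i hi hiu]
  have hblock : ∀ g, st' g = 1 → st g = 1 := by
    intro g hg
    rw [hst'] at hg
    split at hg
    · omega
    · exact hg
  refine ⟨?_, ?_, ?_, ?_, ?_, ?_, ?_, ?_⟩
  · intro i hi b hb
    rw [hV' i hi]
    split
    case isTrue hbu => subst hbu; rw [hsu, h.value i hi _ hb, add_comm]
    case isFalse hbu => rw [hlb b hb hbu, h.value i hi b hb]
  · intro i hi j hj
    by_cases hju : j = u
    · subst hju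
      by_cases hij : i = j
      · subst hij
        exact ⟨∅, by simp, by simp, by simp⟩
      rw [hlj i hi hij, hlu]
      -- An agent who has picked removes the good provided by `surplus`; one who has not did not
      -- envy `u` before and removes `x` itself.
      by_cases hiD : i ∈ D
      · obtain ⟨R, hR, hc, hs⟩ := h.surplus i hi j hj hiD huD x hx hstx
        refine ⟨R, hR.trans (Finset.subset_insert _ _), hc, ?_⟩
        rw [Finset.insert_sdiff_of_notMem _ fun hh => hxu (hR hh), Finset.sum_insert fun hh =>
          hxu (Finset.mem_sdiff.1 hh).1]
        linarith
      · refine ⟨{x}, by simp, by simp, ?_⟩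
        rw [Finset.sdiff_singleton_eq_erase, Finset.erase_insert hxu]
        exact h.noEnvy i hi j hj hiD huD (hrank i hi hiD)
    · rw [hlj j hj hju]
      obtain ⟨R, hR, hc, hs⟩ := h.ef i hi j hj
      exact ⟨R, hR, hc, hs.trans (hmono i hi i)⟩
  · intro i hi j hj hiD hjD g hg hst
    have hju : j ≠ u := fun hh => hjD (by simp [hh])
    have hjD' : j ∉ D := fun hh => hjD (Finset.mem_insert_of_mem hh)
    rw [hlj j hj hju]
    -- The pick turns envy-freeness up to one good into `surplus`, as `x` is worth at least any good
    -- left in the block.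
    by_cases hiu : i = u
    · subst hiu
      obtain ⟨R, hR, hc, hs⟩ := h.ef i hi j hj
      refine ⟨R, hR, hc, ?_⟩
      rw [hsu]
      linarith [hmax g hg (hblock g hst)]
    · rw [hlj i hi hiu]
      exact h.surplus i hi j hj (Finset.mem_of_mem_insert_of_ne hiD hiu) hjD' g hg (hblock g hst)
  · intro i hi j hj hiD hjD hr
    rw [Finset.mem_insert, not_or] at hiD hjD
    rw [hlj i hi hiD.1, hlj j hj hjD.1]
    exact h.noEnvy i hi j hj hiD.2 hjD.2 hr
  · have : labelled m st' 1 = (labelled m st 1).erase x := by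
      ext g
      simp only [mem_labelled, Finset.mem_erase, hst']
      split
      case isTrue hg => simp [hg]
      case isFalse hg => simp [hg]
    rw [this, Finset.card_erase_of_mem (mem_labelled.2 ⟨hx, hstx⟩), h.card_block,
      Finset.card_insert_of_notMem huD]
    omega
  · intro g hg
    have hgx : g ≠ x := by rintro rfl; exact hg hst0
    rw [hst', hlab', if_neg hgx, if_neg hgx]
    exact h.other g hg
  · intro g hg hg1
    rw [hst', hlab']
    split
    · exact Or.inr ⟨rfl, hown⟩
    · exact h.block g hg hg1
  · intro k hk hn
    rcases Finset.mem_insert.1 hk with rfl | hk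
    · exact ⟨x, hx, hst0, by simp [hlab']⟩
    · obtain ⟨g, hg, hg1, hgl⟩ := h.gain k hk hn
      by_cases hgx : g = x
      · have := hlt k (Finset.mem_range.1 (hD hk))
        rw [← hgl, hgx, hlabx] at this
        omega
      · exact ⟨g, hg, hg1, by rw [hlab', if_neg hgx, hgl]⟩

end Pick

/-- The trade of bundles prepares the allocation of the next block. -/
theorem FairState.pickState {n m : ℕ} {v : ℕ → ℕ → ℝ} {own₀ own rank st₀ st lab : ℕ → ℕ}
    {V : ℕ → ℕ → ℝ} (h : FairState n m v own₀ st₀ lab V) (ht : Traded n V own₀ own rank)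
    (hlab : ∀ g < m, st g = 1 → lab g = n) :
    PickState n m v own rank st lab ∅ st lab V := by
  refine ⟨h.value, ?_, by simp, ?_, by simp, by simp, fun g hg h1 => Or.inl ⟨h1, hlab g hg h1⟩,
    by simp⟩
  · intro i hi j hj
    -- The bundle that `j` now holds belonged to some `j'`, towards whom `i` had no envy up to one
    -- good, and the bundle of `i` has only improved.
    obtain ⟨j', hj', hjj⟩ := exists_eq_of_injective_lt h.own_lt h.own_inj (ht.own_lt j hj)
    obtain ⟨R, hR, hc, hs⟩ := h.ef i hi j' hj'
    rw [hjj] at hR hs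
    refine ⟨R, hR, hc, hs.trans ?_⟩
    rw [← h.value i hi _ (h.own_lt i hi), ← h.value i hi _ (ht.own_lt i hi)]
    exact ht.improve i hi
  · intro i hi j hj _ _ hr
    rw [← h.value i hi _ (ht.own_lt j hj), ← h.value i hi _ (ht.own_lt i hi)]
    exact ht.noEnvy i hi j hj hr

/-! ### Social impact -/

/-- The allocation of a block `Q` of at most `n` goods of owner `o`: these are the best free goods
of `o`, and each bundle receives one of them if there are `n`. -/
structure BlockStep (n m o : ℕ) (owner : ℕ → ℕ) (w : ℕ → ℝ) (st lab st' lab' : ℕ → ℕ)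
    (Q : Finset ℕ) : Prop where
  free : ∀ g ∈ Q, g < m ∧ st g = 0 ∧ owner g = o
  allocated : ∀ g ∈ Q, st' g = 2 ∧ lab' g < n
  other : ∀ g < m, g ∉ Q → st' g = st g ∧ lab' g = lab g
  card_le : Q.card ≤ n
  max : ∀ g ∈ Q, ∀ h < m, h ∉ Q → st h = 0 → owner h = o → w h ≤ w g
  exhausted : Q.card < n → ∀ h < m, h ∉ Q → owner h = o → st h ≠ 0
  full : Q.card = n → ∀ b < n, ∃ g ∈ Q, lab' g = b

/-- Each bundle, together with the permanent good, has its share of the social impact of the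
allocated goods of owner `o`; `μ` is a bound on the social impact of the free goods. -/
structure Progress (n m o : ℕ) (owner : ℕ → ℕ) (w : ℕ → ℝ) (st lab : ℕ → ℕ) (μ : ℝ) : Prop where
  nonneg : 0 ≤ μ
  le : ∀ g < m, owner g = o → st g = 0 → w g ≤ μ
  -- The term `(n - 1) * μ` is a credit that pays for a next, possibly incomplete, block.
  share : ∀ b < n, ∑ g ∈ Finset.range m with owner g = o ∧ st g = 2, w g + (n - 1 : ℝ) * μ ≤
    n * ∑ g ∈ Finset.range m with owner g = o ∧ st g = 2 ∧ (lab g = b ∨ lab g = n), w g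

theorem Progress.blockStep {n m o : ℕ} {owner : ℕ → ℕ} {w : ℕ → ℝ} {st lab st' lab' : ℕ → ℕ}
    {Q : Finset ℕ} {μ : ℝ} (h : Progress n m o owner w st lab μ)
    (hQ : BlockStep n m o owner w st lab st' lab' Q) (hw : ∀ g, 0 ≤ w g) (hn : 0 < n) :
    ∃ μ', Progress n m o owner w st' lab' μ' := by
  classical
  have hn1 : (1 : ℝ) ≤ n := by exact_mod_cast hn
  have e1 : (Finset.range m).filter (fun g => owner g = o ∧ st' g = 2) =
      (Finset.range m).filter (fun g => owner g = o ∧ st g = 2) ∪ Q := by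
    ext g
    simp only [Finset.mem_filter, Finset.mem_range, Finset.mem_union]
    by_cases hg : g ∈ Q
    · simp [hg, hQ.free g hg, hQ.allocated g hg]
    · by_cases hm : g < m
      · simp [hg, hm, hQ.other g hm hg]
      · simp [hg, hm]
  have d1 : Disjoint ((Finset.range m).filter (fun g => owner g = o ∧ st g = 2)) Q := by
    rw [Finset.disjoint_left]
    intro g h1 h2
    have h3 := (Finset.mem_filter.1 h1).2.2
    have h4 := (hQ.free g h2).2.1
    omega
  have e2 : ∀ b < n, (Finset.range m).filter
      (fun g => owner g = o ∧ st' g = 2 ∧ (lab' g = b ∨ lab' g = n)) =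
      (Finset.range m).filter (fun g => owner g = o ∧ st g = 2 ∧ (lab g = b ∨ lab g = n)) ∪
        Q.filter (lab' · = b) := by
    intro b hb
    ext g
    simp only [Finset.mem_filter, Finset.mem_range, Finset.mem_union]
    by_cases hg : g ∈ Q
    · have := (hQ.allocated g hg).2.ne
      simp [hg, hQ.free g hg, hQ.allocated g hg, this]
    · by_cases hm : g < m
      · simp [hg, hm, hQ.other g hm hg]
      · simp [hg, hm]
  have d2 : ∀ b, Disjoint ((Finset.range m).filter
      (fun g => owner g = o ∧ st g = 2 ∧ (lab g = b ∨ lab g = n))) (Q.filter (lab' · = b)) := by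
    intro b
    refine Disjoint.mono (Finset.monotone_filter_right _ fun g _ hg => ⟨hg.1, hg.2.1⟩)
      (Finset.filter_subset _ _) d1
  have hle : ∀ g ∈ Q, w g ≤ μ := fun g hg =>
    h.le g (hQ.free g hg).1 (hQ.free g hg).2.2 (hQ.free g hg).2.1
  rcases hQ.card_le.lt_or_eq with hlt | heq
  -- An incomplete block has at most `n - 1` goods of impact at most `μ`, so the credit covers it.
  -- No free good remains, hence the new bound `0`.
  · refine ⟨0, le_rfl, ?_, ?_⟩
    · intro g hg ho hst
      by_cases hgQ : g ∈ Q
      · have := (hQ.allocated g hgQ).1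
        omega
      · rw [(hQ.other g hg hgQ).1] at hst
        exact absurd hst (hQ.exhausted hlt g hg hgQ ho)
    · intro b hb
      rw [e1, e2 b hb, Finset.sum_union d1, Finset.sum_union (d2 b)]
      have h1 : ∑ g ∈ Q, w g ≤ (n - 1 : ℝ) * μ := by
        refine (Finset.sum_le_card_nsmul Q w μ hle).trans ?_
        rw [nsmul_eq_mul]
        refine mul_le_mul_of_nonneg_right ?_ h.nonneg
        have : (Q.card : ℝ) + 1 ≤ n := by exact_mod_cast hlt
        linarith
      have h2 : 0 ≤ ∑ g ∈ Q with lab' g = b, w g := Finset.sum_nonneg fun g _ => hw g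
      have h3 := h.share b hb
      nlinarith
  · obtain ⟨q, hq, hmin⟩ := Q.exists_min_image w (Finset.card_pos.1 (by omega))
    -- In a full block the left side grows by at most `w q + (n - 1) * μ` from the goods and `(n -
    -- 1) * (w q - μ)` from the credit, in total `n * w q`. The right side grows by at least `n * w
    -- q`, as each bundle receives a good no worse than `q`.
    refine ⟨w q, hw q, ?_, ?_⟩
    · intro g hg ho hst
      by_cases hgQ : g ∈ Q
      · have := (hQ.allocated g hgQ).1
        omega
      · rw [(hQ.other g hg hgQ).1] at hst
        exact hQ.max q hq g hg hgQ hst ho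
    · intro b hb
      rw [e1, e2 b hb, Finset.sum_union d1, Finset.sum_union (d2 b)]
      have h1 : ∑ g ∈ Q, w g ≤ w q + (n - 1 : ℝ) * μ := by
        rw [← Finset.add_sum_erase Q w hq]
        refine add_le_add le_rfl ((Finset.sum_le_card_nsmul _ w μ fun g hg =>
          hle g (Finset.mem_of_mem_erase hg)).trans ?_)
        rw [nsmul_eq_mul, Finset.card_erase_of_mem hq, heq, Nat.cast_sub hn, Nat.cast_one]
      have h2 : w q ≤ ∑ g ∈ Q with lab' g = b, w g := by
        obtain ⟨g, hg, hgb⟩ := hQ.full heq b hb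
        exact (hmin g hg).trans (Finset.single_le_sum (f := w) (fun g _ => hw g)
          (Finset.mem_filter.2 ⟨hg, hgb⟩))
      have h3 := h.share b hb
      nlinarith

/-- The goods of owner `o` are all allocated, and each bundle, together with the permanent good, has
its share of their social impact. -/
structure Served (n m o : ℕ) (owner : ℕ → ℕ) (w : ℕ → ℝ) (st lab : ℕ → ℕ) : Prop where
  allocated : ∀ g < m, owner g = o → st g = 2
  share : ∀ b < n, ∑ g ∈ Finset.range m with owner g = o, w g ≤
    n * ∑ g ∈ Finset.range m with owner g = o ∧ (lab g = b ∨ lab g = n), w g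

theorem Progress.served {n m o : ℕ} {owner : ℕ → ℕ} {w : ℕ → ℝ} {st lab : ℕ → ℕ} {μ : ℝ}
    (h : Progress n m o owner w st lab μ) (hall : ∀ g < m, owner g = o → st g = 2) :
    Served n m o owner w st lab := by
  refine ⟨hall, fun b hb => ?_⟩
  have h1 := h.share b hb
  rw [Finset.filter_congr (p := fun g => owner g = o ∧ st g = 2)
      (q := fun g => owner g = o) (fun g hg =>
      ⟨fun hh => hh.1, fun hh => ⟨hh, hall g (Finset.mem_range.1 hg) hh⟩⟩),
    Finset.filter_congr (p := fun g => owner g = o ∧ st g = 2 ∧ (lab g = b ∨ lab g = n))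
      (q := fun g => owner g = o ∧ (lab g = b ∨ lab g = n)) (fun g hg =>
      ⟨fun hh => ⟨hh.1, hh.2.2⟩, fun hh => ⟨hh.1, hall g (Finset.mem_range.1 hg) hh.1, hh.2⟩⟩)] at h1
  have hn1 : (1 : ℝ) ≤ n := by exact_mod_cast (by omega : 1 ≤ n)
  nlinarith [h.nonneg]

/-- Allocated goods keep their labels, so earlier owners remain served while later ones are treated.
-/
theorem Served.congr {n m o : ℕ} {owner : ℕ → ℕ} {w : ℕ → ℝ} {st lab st' lab' : ℕ → ℕ}
    (h : Served n m o owner w st lab)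
    (heq : ∀ g < m, st g = 2 → st' g = 2 ∧ lab' g = lab g) :
    Served n m o owner w st' lab' := by
  refine ⟨fun g hg ho => (heq g hg (h.allocated g hg ho)).1, fun b hb => ?_⟩
  rw [Finset.filter_congr (p := fun g => owner g = o ∧ (lab' g = b ∨ lab' g = n))
    (q := fun g => owner g = o ∧ (lab g = b ∨ lab g = n)) (fun g hg => and_congr_right fun ho => by
      have hg := Finset.mem_range.1 hg
      rw [(heq g hg (h.allocated g hg ho)).2])]
  exact h.share b hb

/-- Every agent has at most one permanent good, and only goods of owners below `o` are allocated. -/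
structure Permanent (n m o : ℕ) (owner st lab : ℕ → ℕ) : Prop where
  lt : ∀ g < m, st g ≠ 0 → owner g < o
  unique : ∀ g < m, ∀ h < m, st g = 2 → lab g = n → st h = 2 → lab h = n → owner g = owner h →
    g = h

theorem BlockStep.permanent {n m o p : ℕ} {owner : ℕ → ℕ} {w : ℕ → ℝ} {st lab st' lab' : ℕ → ℕ}
    {Q : Finset ℕ} (hQ : BlockStep n m o owner w st lab st' lab' Q) (hop : o < p)
    (h : Permanent n m p owner st lab) : Permanent n m p owner st' lab' := by
  have key : ∀ g < m, lab' g = n → st' g = st g ∧ lab' g = lab g := by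
    intro g hg h2
    refine hQ.other g hg fun hgQ => ?_
    have := (hQ.allocated g hgQ).2
    omega
  refine ⟨fun g hg h1 => ?_, fun g hg k hk h1 h2 h3 h4 => ?_⟩
  · by_cases hgQ : g ∈ Q
    · rw [(hQ.free g hgQ).2.2]
      exact hop
    · rw [(hQ.other g hg hgQ).1] at h1
      exact h.lt g hg h1
  · obtain ⟨a, b⟩ := key g hg h2
    obtain ⟨c, d⟩ := key k hk h4
    exact h.unique g hg k hk (a ▸ h1) (b ▸ h2) (c ▸ h3) (d ▸ h4)

theorem BlockStep.served {n m o p : ℕ} {owner : ℕ → ℕ} {w u : ℕ → ℝ} {st lab st' lab' : ℕ → ℕ}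
    {Q : Finset ℕ} (hQ : BlockStep n m o owner w st lab st' lab' Q)
    (h : Served n m p owner u st lab) : Served n m p owner u st' lab' := by
  refine h.congr fun g hg h1 => ?_
  have hgQ : g ∉ Q := fun hh => by
    have := (hQ.free g hh).2.1
    omega
  rwa [(hQ.other g hg hgQ).1, (hQ.other g hg hgQ).2, and_iff_left rfl]

/-- The free goods of owner `o`. -/
def freeGoods (m o : ℕ) (owner st : ℕ → ℕ) : Finset ℕ :=
  (Finset.range m).filter fun g => owner g = o ∧ st g = 0

/-- Progress measure for the loop over blocks. The truncated difference also covers an empty block,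
which occurs only when no good is left. -/
theorem BlockStep.card_freeGoods {n m o : ℕ} {owner : ℕ → ℕ} {w : ℕ → ℝ}
    {st lab st' lab' : ℕ → ℕ} {Q : Finset ℕ} (hQ : BlockStep n m o owner w st lab st' lab' Q)
    (hn : 0 < n) :
    (freeGoods m o owner st').card ≤ (freeGoods m o owner st).card - 1 := by
  have hsub : freeGoods m o owner st' ⊆ freeGoods m o owner st \ Q := by
    intro g hg
    simp only [freeGoods, Finset.mem_filter, Finset.mem_range, Finset.mem_sdiff] at hg ⊢
    have hgQ : g ∉ Q := fun hh => by
      have := (hQ.allocated g hh).1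
      omega
    rw [(hQ.other g hg.1 hgQ).1] at hg
    exact ⟨hg, hgQ⟩
  have hc := Finset.card_le_card hsub
  rcases Q.eq_empty_or_nonempty with h0 | h0
  · have : freeGoods m o owner st = ∅ := by
      rw [Finset.eq_empty_iff_forall_notMem]
      intro g hg
      simp only [freeGoods, Finset.mem_filter, Finset.mem_range] at hg
      exact hQ.exhausted (by simp [h0, hn]) g hg.1 (by simp [h0]) hg.2.1 hg.2.2
    rw [this, Finset.empty_sdiff, Finset.card_empty] at hc
    omega
  · have hQs : Q ⊆ freeGoods m o owner st := fun g hg => by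
      simp only [freeGoods, Finset.mem_filter, Finset.mem_range]
      exact ⟨(hQ.free g hg).1, (hQ.free g hg).2.2, (hQ.free g hg).2.1⟩
    rw [Finset.card_sdiff_of_subset hQs] at hc
    have := Finset.card_pos.2 h0
    omega

end SocialImpact

namespace SocialImpact
namespace Prog

/-! ### Allocating a block -/

/-- The best free good of the agent in the counter `13`. -/
def select : Prog :=
  argmax 1 (.and (.natLe (entry 6 (scalar 21)) (.const 0))
    (.and (.natLe (entry 1 (scalar 21)) (scalar 13)) (.natLe (scalar 13) (entry 1 (scalar 21)))))
    (.read 1 (scalar 13) (scalar 21))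

/-- Setting the state of the good that has been selected, if there is one. -/
def mark (x : ℕ) : Prog :=
  cond (.natLe (.add (scalar 20) (.const 1)) (bound 1)) (setNat 6 (.const 0) (scalar 20) (.const x))

def gather : Prog := rep 15 0 (seq select (mark 1))

/-- Adding the selected good to the values of the bundle of the agent in the counter `17`. -/
def addValue : Prog :=
  rep 18 0 (setReal 2 (scalar 18) (entry 4 (scalar 17))
    (.add (.read 2 (scalar 18) (entry 4 (scalar 17))) (.read 0 (scalar 18) (scalar 20))))

def pickGood : Prog :=
  seq (argmax 1 (.and (.natLe (.const 1) (entry 6 (scalar 21)))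
      (.natLe (entry 6 (scalar 21)) (.const 1))) (.read 0 (scalar 17) (scalar 21)))
    (cond (.natLe (.add (scalar 20) (.const 1)) (bound 1))
      (seq (setNat 5 (.const 0) (scalar 20) (entry 4 (scalar 17)))
        (seq (setNat 6 (.const 0) (scalar 20) (.const 2)) addValue)))

/-- Selects rank `n - 1 - t` in round `t`, so that ranks are served in decreasing order. -/
def pickTest : BExp :=
  .and (.natLe (.add (entry 7 (scalar 17)) (.add (scalar 16) (.const 1))) (bound 0))
    (.natLe (bound 0) (.add (entry 7 (scalar 17)) (.add (scalar 16) (.const 1))))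

def picks : Prog := rep 16 0 (rep 17 0 (cond pickTest pickGood))

def block : Prog := seq gather (seq trade picks)

theorem run_select {σ : Mem} {m o : ℕ} (hm : σ.nat 0 0 1 = m) (ho : σ.nat 13 0 0 = o) {ρ : Mem}
    (hρ : select.run σ = ρ) :
    SearchFrame σ ρ ∧
    ((ρ.nat 20 0 0 = m ∧ ∀ g < m, ¬ (σ.nat 6 0 g = 0 ∧ σ.nat 1 0 g = o)) ∨
      (ρ.nat 20 0 0 < m ∧ (σ.nat 6 0 (ρ.nat 20 0 0) = 0 ∧ σ.nat 1 0 (ρ.nat 20 0 0) = o) ∧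
        ∀ g < m, σ.nat 6 0 g = 0 ∧ σ.nat 1 0 g = o →
          σ.real 1 o g ≤ σ.real 1 o (ρ.nat 20 0 0))) := by
  rw [← hm]
  refine run_argmax _ _ _ σ (fun g => σ.nat 6 0 g = 0 ∧ σ.nat 1 0 g = o)
    (fun g => σ.real 1 o g) ?_ ?_ hρ
  · intro τ hτ
    simp only [BExp.Holds, NExp.eval, hτ.1 1 (by decide) (by decide),
      hτ.1 6 (by decide) (by decide), hτ.1 13 (by decide) (by decide), ho]
    omega
  · intro τ hτ
    simp [RExp.eval, NExp.eval, hτ.1, hτ.2, ho]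

theorem run_mark_of_lt {σ : Mem} (h : σ.nat 20 0 0 < σ.nat 0 0 1) (x : ℕ) :
    (mark x).run σ = σ.writeNat 6 0 (σ.nat 20 0 0) x :=
  run_cond_of_holds (by simpa [BExp.Holds, NExp.eval] using h) _

theorem run_mark_of_eq {σ : Mem} (h : σ.nat 20 0 0 = σ.nat 0 0 1) (x : ℕ) :
    (mark x).run σ = σ :=
  run_cond_of_not_holds (by simp [BExp.Holds, NExp.eval, h]) _

/-- The result `st'` of gathering a block of best free goods of owner `o`, given the states `st` and
the size limit `n`. -/
structure Gathered (n m o : ℕ) (owner : ℕ → ℕ) (w : ℕ → ℝ) (st st' : ℕ → ℕ) : Prop where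
  state : ∀ g, st' g = st g ∨ (g < m ∧ st g = 0 ∧ owner g = o ∧ st' g = 1)
  card_le : (labelled m st' 1).card ≤ n
  exhausted : (labelled m st' 1).card = n ∨ ∀ h < m, owner h = o → st' h ≠ 0
  max : ∀ g < m, st' g = 1 → ∀ h < m, st' h = 0 → owner h = o → w h ≤ w g

theorem run_gather {σ : Mem} {n m o : ℕ} (hn : σ.nat 0 0 0 = n) (hm : σ.nat 0 0 1 = m)
    (ho : σ.nat 13 0 0 = o) (hst : ∀ g < m, σ.nat 6 0 g ≠ 1) :
    Gathered n m o (σ.nat 1 0) (σ.real 1 o) (σ.nat 6 0) ((gather.run σ).nat 6 0) := by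
  -- The invariant is the claim itself with size limit `k`.
  refine run_rep hn (fun k τ =>
    Gathered k m o (σ.nat 1 0) (σ.real 1 o) (σ.nat 6 0) (τ.nat 6 0)) (by decide) ?_ ?_
  · simp only [ne_eq, Nat.reduceEqDiff, not_false_eq_true, Mem.writeNat_nat_of_ne]
    have h0 : labelled m (σ.nat 6 0) 1 = ∅ := by
      rw [Finset.eq_empty_iff_forall_notMem]
      exact fun g hg => hst g (mem_labelled.1 hg).1 (mem_labelled.1 hg).2
    exact ⟨fun g => Or.inl rfl, by simp [h0], Or.inl (by simp [h0]),
      fun g hg h1 => absurd h1 (hst g hg)⟩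
  · intro k τ hk hτk hfn hfr hI
    have f0 : τ.nat 0 = σ.nat 0 := hfn 0 (by decide)
    have f1 : τ.nat 1 = σ.nat 1 := hfn 1 (by decide)
    have f13 : τ.nat 13 = σ.nat 13 := hfn 13 (by decide)
    have r1 : τ.real 1 = σ.real 1 := hfr 1 (by decide)
    rw [Mem.writeNat_nat_of_ne _ (by decide), run_seq]
    generalize hρ : select.run τ = ρ
    obtain ⟨hsf, h⟩ := run_select (by rw [f0, hm]) (by rw [f13, ho]) hρ
    have g0 : ρ.nat 0 = τ.nat 0 := hsf.1 0 (by decide) (by decide)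
    have g6 : ρ.nat 6 = τ.nat 6 := hsf.1 6 (by decide) (by decide)
    rw [f1, r1] at h
    rcases h with ⟨h1, h2⟩ | ⟨h1, h2, h3⟩
    · rw [run_mark_of_eq (by rw [h1, g0, f0, hm]), g6]
      exact ⟨hI.state, hI.card_le.trans (by omega),
        Or.inr fun g hg hgo hg0 => h2 g hg ⟨hg0, hgo⟩, hI.max⟩
    · rw [run_mark_of_lt (by rw [g0, f0, hm]; exact h1)]
      generalize ρ.nat 20 0 0 = x at *
      have hst' : ∀ g, (ρ.writeNat 6 0 x 1).nat 6 0 g = if g = x then 1 else τ.nat 6 0 g := by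
        intro g
        simp [g6]
      have hQ : labelled m ((ρ.writeNat 6 0 x 1).nat 6 0) 1 =
          insert x (labelled m (τ.nat 6 0) 1) := by
        ext g
        simp only [mem_labelled, Finset.mem_insert, hst']
        split
        case isTrue hg => simp [hg, h1]
        case isFalse hg => simp [hg]
      have hxQ : x ∉ labelled m (τ.nat 6 0) 1 := fun hh => by
        have := (mem_labelled.1 hh).2
        omega
      -- A free good of the owner was still found, so the gathering has not stopped early.
      have hcard : (labelled m (τ.nat 6 0) 1).card = k := by
        rcases hI.exhausted with h4 | h4
        · exact h4
        · exact absurd h2.1 (h4 x h1 h2.2)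
      refine ⟨?_, ?_, Or.inl ?_, ?_⟩
      · intro g
        rw [hst']
        split
        case isTrue hg =>
          subst hg
          right
          refine ⟨h1, ?_, h2.2, rfl⟩
          rcases hI.state g with h5 | h5
          · rw [← h5]; exact h2.1
          · exact h5.2.1
        case isFalse hg => exact hI.state g
      · rw [hQ, Finset.card_insert_of_notMem hxQ, hcard]
      · rw [hQ, Finset.card_insert_of_notMem hxQ, hcard]
      · intro g hg hg1 h hh hh0 hho
        rw [hst'] at hg1 hh0
        have hhx : h ≠ x := by rintro rfl; simp at hh0
        rw [if_neg hhx] at hh0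
        by_cases hgx : g = x
        · rw [hgx]; exact h3 h hh ⟨hh0, hho⟩
        · rw [if_neg hgx] at hg1
          exact hI.max g hg hg1 h hh hh0 hho

theorem run_addValue {σ : Mem} {n u x b : ℕ} (hn : σ.nat 0 0 0 = n) (hu : σ.nat 17 0 0 = u)
    (hx : σ.nat 20 0 0 = x) (hb : σ.nat 4 0 u = b) :
    ∀ k < n, ∀ c, (addValue.run σ).real 2 k c =
      if c = b then σ.real 2 k c + σ.real 0 k x else σ.real 2 k c := by
  have key := run_rep hn (c := 18) (p := setReal 2 (scalar 18) (entry 4 (scalar 17))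
    (.add (.read 2 (scalar 18) (entry 4 (scalar 17))) (.read 0 (scalar 18) (scalar 20))))
    (fun j τ => ∀ k c, τ.real 2 k c =
      if k < j ∧ c = b then σ.real 2 k c + σ.real 0 k x else σ.real 2 k c) (by decide) (by simp) ?_
  · intro k hk c
    exact (key k c).trans (by simp [hk])
  · intro j τ hj hτj hfn hfr hI k c
    have f4 : τ.nat 4 = σ.nat 4 := hfn 4 (by decide)
    have f17 : τ.nat 17 = σ.nat 17 := hfn 17 (by decide)
    have f20 : τ.nat 20 = σ.nat 20 := hfn 20 (by decide)
    have r0 : τ.real 0 = σ.real 0 := hfr 0 (by decide)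
    simp only [run_setReal, NExp.eval, RExp.eval, hτj, f4, f17, f20, r0, hu, hx, hb,
      Mem.writeNat_real, Mem.writeReal_real, hI]
    by_cases hkj : k = j
    · subst hkj
      by_cases hc : c = b
      · subst hc; simp
      · simp [hc]
    · have : k < j + 1 ↔ k < j := by omega
      simp [hkj, this]

theorem run_pickGood {τ : Mem} {n m u : ℕ} {v : ℕ → ℕ → ℝ} {own rank st₀ lab₀ : ℕ → ℕ}
    {D : Finset ℕ} (hn : τ.nat 0 0 0 = n) (hm : τ.nat 0 0 1 = m) (hτu : τ.nat 17 0 0 = u)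
    (hown : τ.nat 4 0 = own) (hv : τ.real 0 = v) (hv0 : ∀ i g, 0 ≤ v i g)
    (hlt : ∀ i < n, own i < n) (hinj : ∀ i < n, ∀ j < n, own i = own j → i = j)
    (hu : u < n) (hD : D ⊆ Finset.range n) (huD : u ∉ D)
    (hrank : ∀ k < n, k ∉ D → rank k ≤ rank u)
    (h : PickState n m v own rank st₀ lab₀ D (τ.nat 6 0) (τ.nat 5 0) (τ.real 2)) :
    PickState n m v own rank st₀ lab₀ (insert u D) ((pickGood.run τ).nat 6 0)
      ((pickGood.run τ).nat 5 0) ((pickGood.run τ).real 2) := by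
  rw [pickGood, run_seq]
  generalize hρ : Prog.run (argmax _ _ _) τ = ρ
  obtain ⟨hsf, hr⟩ := run_argmax _ _ _ τ (fun g => τ.nat 6 0 g = 1) (fun g => v u g)
    (fun ρ hρ => by simp [BExp.Holds, NExp.eval, hρ.1, le_antisymm_iff, and_comm])
    (fun ρ hρ => by simp [RExp.eval, NExp.eval, hρ.1, hρ.2, hv, hτu]) hρ
  have g0 : ρ.nat 0 = τ.nat 0 := hsf.1 0 (by decide) (by decide)
  have g4 : ρ.nat 4 = τ.nat 4 := hsf.1 4 (by decide) (by decide)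
  have g5 : ρ.nat 5 = τ.nat 5 := hsf.1 5 (by decide) (by decide)
  have g6 : ρ.nat 6 = τ.nat 6 := hsf.1 6 (by decide) (by decide)
  have g17 : ρ.nat 17 = τ.nat 17 := hsf.1 17 (by decide) (by decide)
  have s0 : ρ.real 0 = τ.real 0 := hsf.2 0 (by decide)
  have s2 : ρ.real 2 = τ.real 2 := hsf.2 2 (by decide)
  rw [hm] at hr
  rcases hr with ⟨h1, h2⟩ | ⟨h1, h2, h3⟩
  · rw [run_cond_of_not_holds (by simp [BExp.Holds, NExp.eval, h1, g0, hm]), g5, g6, s2]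
    exact h.skip hu hD huD h2
  · rw [run_cond_of_holds (by simpa [BExp.Holds, NExp.eval, g0, hm] using h1)]
    simp only [run_seq, run_setNat, NExp.eval]
    generalize hx : ρ.nat 20 0 0 = x at *
    set π := (ρ.writeNat 5 0 x (ρ.nat 4 0 (ρ.nat 17 0 0))) with hπ
    have hx' : π.nat 20 0 0 = x := by simp [hπ, hx]
    rw [hx']
    have hval := run_addValue (σ := π.writeNat 6 0 x 2) (n := n) (u := u) (x := x) (b := own u)
      (by simp [hπ, g0, hn]) (by simp [hπ, g17, hτu]) (by simp [hx']) (by simp [hπ, g4, hown])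
    refine h.pick hv0 hlt hinj hu hD huD hrank h1 h2 h3 ?_ ?_ ?_
    · intro g
      rw [addValue, run_nat_of_notMem _ (by decide)]
      simp [hπ, g6]
    · intro g
      rw [addValue, run_nat_of_notMem _ (by decide)]
      simp [hπ, g5, g17, g4, hτu, hown]
    · intro k hk b
      rw [hval k hk b]
      simp [hπ, s2, s0, hv]

theorem run_picks {σ : Mem} {n m : ℕ} (hn : σ.nat 0 0 0 = n) (hm : σ.nat 0 0 1 = m)
    (hv0 : ∀ i g, 0 ≤ σ.real 0 i g) (hlt : ∀ i < n, σ.nat 4 0 i < n)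
    (hinj : ∀ i < n, ∀ j < n, σ.nat 4 0 i = σ.nat 4 0 j → i = j)
    (hrank : ∀ i < n, σ.nat 7 0 i < n)
    (h : PickState n m (σ.real 0) (σ.nat 4 0) (σ.nat 7 0) (σ.nat 6 0) (σ.nat 5 0) ∅ (σ.nat 6 0)
      (σ.nat 5 0) (σ.real 2)) :
    PickState n m (σ.real 0) (σ.nat 4 0) (σ.nat 7 0) (σ.nat 6 0) (σ.nat 5 0) (Finset.range n)
      ((picks.run σ).nat 6 0) ((picks.run σ).nat 5 0) ((picks.run σ).real 2) := by
  rw [picks]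
  -- After `t` rounds exactly the agents of rank at least `n - t` have picked; within a round, ties
  -- are broken by index.
  have key := run_rep hn (c := 16) (p := rep 17 0 (cond pickTest pickGood)) (fun t τ =>
    PickState n m (σ.real 0) (σ.nat 4 0) (σ.nat 7 0) (σ.nat 6 0) (σ.nat 5 0)
      ((Finset.range n).filter (n ≤ σ.nat 7 0 · + t)) (τ.nat 6 0) (τ.nat 5 0) (τ.real 2))
    (by decide) ?_ ?_
  · convert key using 1
    exact (Finset.filter_true_of_mem fun k _ => by omega).symm
  · rw [Finset.filter_false_of_mem fun k hk => by
      have := hrank k (Finset.mem_range.1 hk)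
      omega]
    simpa using h
  · intro t τ ht hτt hfn hfr hI
    have f0 : τ.nat 0 = σ.nat 0 := hfn 0 (by decide)
    have f4 : τ.nat 4 = σ.nat 4 := hfn 4 (by decide)
    have f7 : τ.nat 7 = σ.nat 7 := hfn 7 (by decide)
    have r0 : τ.real 0 = σ.real 0 := hfr 0 (by decide)
    have key := run_rep (n := n) (σ := τ) (by rw [f0, hn]) (c := 17) (p := cond pickTest pickGood)
      (fun i τ => PickState n m (σ.real 0) (σ.nat 4 0) (σ.nat 7 0) (σ.nat 6 0) (σ.nat 5 0)
        ((Finset.range n).filter fun k =>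
          n ≤ σ.nat 7 0 k + t ∨ (σ.nat 7 0 k + (t + 1) = n ∧ k < i))
        (τ.nat 6 0) (τ.nat 5 0) (τ.real 2)) (by decide) ?_ ?_
    · simp only [ne_eq, Nat.reduceEqDiff, not_false_eq_true, Mem.writeNat_nat_of_ne,
        Mem.writeNat_real]
      convert key using 1
      refine Finset.filter_congr fun k hk => ?_
      have := Finset.mem_range.1 hk
      omega
    · simpa using hI
    · intro i π hi hπi hfn' hfr' hJ
      have k0 : π.nat 0 = σ.nat 0 := (hfn' 0 (by decide)).trans f0
      have k4 : π.nat 4 = σ.nat 4 := (hfn' 4 (by decide)).trans f4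
      have k7 : π.nat 7 = σ.nat 7 := (hfn' 7 (by decide)).trans f7
      have k16 : π.nat 16 = τ.nat 16 := hfn' 16 (by decide)
      have l0 : π.real 0 = σ.real 0 := (hfr' 0 (by decide)).trans r0
      have htest : pickTest.Holds π ↔ σ.nat 7 0 i + (t + 1) = n := by
        simp only [pickTest, BExp.Holds, NExp.eval, k0, k7, k16, hπi, hτt, hn]
        omega
      simp only [ne_eq, Nat.reduceEqDiff, not_false_eq_true, Mem.writeNat_nat_of_ne,
        Mem.writeNat_real]
      by_cases hti : σ.nat 7 0 i + (t + 1) = n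
      · rw [run_cond_of_holds (htest.2 hti)]
        have := run_pickGood (by rw [k0, hn]) (by rw [k0, hm]) hπi (by rw [k4]) l0 hv0 hlt hinj hi
          (Finset.filter_subset _ _) (by simp; omega) ?_ hJ
        · convert this using 1
          ext k
          simp only [Finset.mem_filter, Finset.mem_range, Finset.mem_insert]
          by_cases hki : k = i
          · subst hki; simp [hi, hti]
          · have : k < i + 1 ↔ k < i := by omega
            simp [hki, this]
        · intro k hk hkD
          simp only [Finset.mem_filter, Finset.mem_range] at hkD
          omega
      · rw [run_cond_of_not_holds fun hh => hti (htest.1 hh)]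
        convert hJ using 1
        refine Finset.filter_congr fun k hk => ?_
        by_cases hki : k = i
        · subst hki; simp [hti]
        · have : k < i + 1 ↔ k < i := by omega
          rw [this]

end Prog
end SocialImpact

namespace SocialImpact
namespace Prog

/-- Separates the two concerns: fairness for `v` is preserved, and for the social impact only the
abstract `BlockStep` is kept. -/
theorem run_block {σ : Mem} {n m o : ℕ} (hn : σ.nat 0 0 0 = n) (hm : σ.nat 0 0 1 = m)
    (ho : σ.nat 13 0 0 = o) (hv0 : ∀ i g, 0 ≤ σ.real 0 i g)
    (h : FairState n m (σ.real 0) (σ.nat 4 0) (σ.nat 6 0) (σ.nat 5 0) (σ.real 2)) :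
    FairState n m (σ.real 0) ((block.run σ).nat 4 0) ((block.run σ).nat 6 0)
      ((block.run σ).nat 5 0) ((block.run σ).real 2) ∧
    ∃ Q, BlockStep n m o (σ.nat 1 0) (σ.real 1 o) (σ.nat 6 0) (σ.nat 5 0)
      ((block.run σ).nat 6 0) ((block.run σ).nat 5 0) Q := by
  have hst1 : ∀ g < m, σ.nat 6 0 g ≠ 1 := fun g hg => by
    rcases h.status g hg with h1 | h1 <;> omega
  rw [block, run_seq, run_seq]
  have hA := run_gather hn hm ho hst1
  set A := gather.run σ
  have A0 : A.nat 0 = σ.nat 0 := run_nat_of_notMem _ (by decide) _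
  have A4 : A.nat 4 = σ.nat 4 := run_nat_of_notMem _ (by decide) _
  have A5 : A.nat 5 = σ.nat 5 := run_nat_of_notMem _ (by decide) _
  have A2 : A.real 2 = σ.real 2 := run_real_of_notMem _ (by decide) _
  have A0' : A.real 0 = σ.real 0 := run_real_of_notMem _ (by decide) _
  have hB := run_trade (σ := A) (n := n) (by rw [A0, hn]) (by rw [A4]; exact h.own_lt)
    (by rw [A4]; exact h.own_inj)
  set B := trade.run A
  have B0 : B.nat 0 = A.nat 0 := run_nat_of_notMem _ (by decide) _
  have B5 : B.nat 5 = A.nat 5 := run_nat_of_notMem _ (by decide) _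
  have B6 : B.nat 6 = A.nat 6 := run_nat_of_notMem _ (by decide) _
  have B2 : B.real 2 = A.real 2 := run_real_of_notMem _ (by decide) _
  have B0' : B.real 0 = A.real 0 := run_real_of_notMem _ (by decide) _
  rw [A2, A4] at hB
  have hlab : ∀ g < m, A.nat 6 0 g = 1 → σ.nat 5 0 g = n := by
    intro g hg hg1
    rcases hA.state g with h1 | h1
    · exact absurd (h1 ▸ hg1) (hst1 g hg)
    · rcases h.status g hg with h2 | h2 <;> omega
  have hP := h.pickState hB hlab
  have hC := run_picks (σ := B) (n := n) (m := m) (by rw [B0, A0, hn]) (by rw [B0, A0, hm])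
    (by rw [B0', A0']; exact hv0) hB.own_lt hB.own_inj hB.rank_lt
    (by rw [B0', A0', B5, A5, B6, B2, A2]; exact hP)
  set C := picks.run B
  have C4 : C.nat 4 = B.nat 4 := run_nat_of_notMem _ (by decide) _
  rw [B0', A0', B5, A5, B6] at hC
  -- The block has at most `n` goods and all `n` agents have had their turn.
  have hempty : ∀ g < m, C.nat 6 0 g ≠ 1 := by
    intro g hg hg1
    have h1 := hC.card_block
    rw [Finset.card_range] at h1
    have h2 := hA.card_le
    have h3 : 0 < (labelled m (C.nat 6 0) 1).card :=
      Finset.card_pos.2 ⟨g, mem_labelled.2 ⟨hg, hg1⟩⟩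
    omega
  have hfree : ∀ g < m, A.nat 6 0 g = 1 → σ.nat 6 0 g = 0 ∧ σ.nat 1 0 g = o := by
    intro g hg hg1
    rcases hA.state g with h1 | h1
    · exact absurd (h1 ▸ hg1) (hst1 g hg)
    · exact ⟨h1.2.1, h1.2.2.1⟩
  have hin : ∀ g < m, A.nat 6 0 g = 1 → C.nat 6 0 g = 2 ∧ C.nat 5 0 g < n := by
    intro g hg hg1
    exact (hC.block g hg hg1).resolve_left fun hh => hempty g hg hh.1
  have hout : ∀ g, A.nat 6 0 g ≠ 1 → C.nat 6 0 g = σ.nat 6 0 g ∧ C.nat 5 0 g = σ.nat 5 0 g := by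
    intro g hg1
    obtain ⟨h1, h2⟩ := hC.other g hg1
    refine ⟨h1.trans ?_, h2⟩
    rcases hA.state g with h3 | h3
    · exact h3
    · exact absurd h3.2.2.2 hg1
  refine ⟨⟨?_, ?_, hC.value, ?_, ?_⟩, labelled m (A.nat 6 0) 1, ?_, ?_, ?_, hA.card_le, ?_, ?_, ?_⟩
  · rw [C4]; exact hB.own_lt
  · rw [C4]; exact hB.own_inj
  · rw [C4]; exact hC.ef
  · intro g hg
    by_cases hg1 : A.nat 6 0 g = 1
    · exact Or.inr ⟨(hin g hg hg1).1, (hin g hg hg1).2.le⟩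
    · rw [(hout g hg1).1, (hout g hg1).2]
      exact h.status g hg
  · intro g hg
    rw [mem_labelled] at hg
    exact ⟨hg.1, hfree g hg.1 hg.2⟩
  · intro g hg
    rw [mem_labelled] at hg
    exact hin g hg.1 hg.2
  · intro g hg hgQ
    exact hout g fun hh => hgQ (mem_labelled.2 ⟨hg, hh⟩)
  · intro g hg k hk hkQ hk0 hko
    rw [mem_labelled] at hg
    refine hA.max g hg.1 hg.2 k hk ?_ hko
    rcases hA.state k with h1 | h1
    · rw [h1, hk0]
    · exact absurd (mem_labelled.2 ⟨hk, h1.2.2.2⟩) hkQ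
  · intro hlt k hk hkQ hko hk0
    rcases hA.exhausted with h1 | h1
    · omega
    · refine h1 k hk hko ?_
      rcases hA.state k with h1 | h1
      · rw [h1, hk0]
      · exact absurd (mem_labelled.2 ⟨hk, h1.2.2.2⟩) hkQ
  · intro hfull b hb
    obtain ⟨u, hu, rfl⟩ := exists_eq_of_injective_lt hB.own_lt hB.own_inj hb
    obtain ⟨g, hg, hg1, hgl⟩ := hC.gain u (Finset.mem_range.2 hu) hfull
    exact ⟨g, mem_labelled.2 ⟨hg, hg1⟩, hgl⟩

/-! ### The whole program -/

/-- The permanent good goes directly to state `2` and keeps the label `n`, outside all bundles. Then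
`m` blocks suffice, superfluous ones being empty. -/
def allocate : Prog := rep 13 0 (seq (seq select (mark 2)) (rep 14 1 block))

def setup : Prog :=
  seq (rep 13 1 (seq (argmax 0 (.natLe (.const 0) (.const 0)) (.read 1 (scalar 21) (scalar 13)))
      (seq (setNat 1 (.const 0) (scalar 13) (scalar 20))
        (setNat 5 (.const 0) (scalar 13) (bound 0)))))
    (rep 13 0 (setNat 4 (.const 0) (scalar 13) (scalar 13)))

/-- The label `n` of a permanent good matches no bundle, so its entry in array `1` keeps the owner;
all other entries are overwritten by the holder of the bundle. -/
def finish : Prog :=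
  rep 13 1 (rep 14 0 (cond
    (.and (.natLe (entry 5 (scalar 13)) (entry 4 (scalar 14)))
      (.natLe (entry 4 (scalar 14)) (entry 5 (scalar 13))))
    (setNat 1 (.const 0) (scalar 13) (scalar 14))))

def whole : Prog := seq setup (seq allocate finish)

theorem wellFormed_whole : whole.WellFormed := by
  simp [whole, setup, allocate, finish, block, gather, trade, picks, select, mark, favourites,
    leave, exchange, pickGood, addValue, WellFormed, natWrites]

theorem run_permanent {σ : Mem} {n m o : ℕ} (hm : σ.nat 0 0 1 = m)
    (ho : σ.nat 13 0 0 = o) (hs0 : ∀ i g, 0 ≤ σ.real 1 i g) {v : ℕ → ℕ → ℝ}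
    (h : FairState n m v (σ.nat 4 0) (σ.nat 6 0) (σ.nat 5 0) (σ.real 2))
    (hp : Permanent n m o (σ.nat 1 0) (σ.nat 6 0) (σ.nat 5 0)) {τ : Mem}
    (hτ : (seq select (mark 2)).run σ = τ) :
    FairState n m v (σ.nat 4 0) (τ.nat 6 0) (σ.nat 5 0) (σ.real 2) ∧
    Permanent n m (o + 1) (σ.nat 1 0) (τ.nat 6 0) (σ.nat 5 0) ∧
    (∃ μ, Progress n m o (σ.nat 1 0) (σ.real 1 o) (τ.nat 6 0) (σ.nat 5 0) μ) ∧
    ∀ g < m, σ.nat 6 0 g = 2 → τ.nat 6 0 g = 2 := by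
  subst hτ
  rw [run_seq]
  generalize hρ : select.run σ = ρ
  obtain ⟨hsf, hr⟩ := run_select hm ho hρ
  have g0 : ρ.nat 0 = σ.nat 0 := hsf.1 0 (by decide) (by decide)
  have g6 : ρ.nat 6 = σ.nat 6 := hsf.1 6 (by decide) (by decide)
  -- So far only goods of earlier owners have been touched.
  have hfree : ∀ g < m, σ.nat 1 0 g = o → σ.nat 6 0 g = 0 := by
    intro g hg hgo
    by_contra hne
    have := hp.lt g hg hne
    omega
  rcases hr with ⟨h1, h2⟩ | ⟨h1, ⟨h2, h2'⟩, h3⟩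
  · rw [run_mark_of_eq (by rw [h1, g0, hm]), g6]
    have hno : ∀ g < m, σ.nat 1 0 g ≠ o := fun g hg hgo => h2 g hg ⟨hfree g hg hgo, hgo⟩
    refine ⟨h, ⟨fun g hg hne => (hp.lt g hg hne).trans (by omega), hp.unique⟩,
      ⟨0, le_rfl, fun g hg hgo => absurd hgo (hno g hg), fun b hb => ?_⟩, fun g _ h => h⟩
    rw [Finset.filter_false_of_mem fun g hg hh => hno g (Finset.mem_range.1 hg) hh.1,
      Finset.filter_false_of_mem fun g hg hh => hno g (Finset.mem_range.1 hg) hh.1]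
    simp
  · rw [run_mark_of_lt (by rw [g0, hm]; exact h1)]
    generalize ρ.nat 20 0 0 = x at *
    have hst' : ∀ g, (ρ.writeNat 6 0 x 2).nat 6 0 g = if g = x then 2 else σ.nat 6 0 g := by
      intro g
      simp [g6]
    have hlabx : σ.nat 5 0 x = n := by
      rcases h.status x h1 with h4 | h4 <;> omega
    generalize (ρ.writeNat 6 0 x 2).nat 6 0 = st' at *
    have honly : ∀ g < m, σ.nat 1 0 g = o → st' g = 2 → g = x := by
      intro g hg hgo hg2
      by_contra hgx
      rw [hst', if_neg hgx, hfree g hg hgo] at hg2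
      omega
    -- The initial `μ` is the impact of the permanent good `x`, the largest one. The share then
    -- holds with equality, as `w x + (n - 1) * w x = n * w x`.
    refine ⟨⟨h.own_lt, h.own_inj, h.value, h.ef, ?_⟩, ⟨?_, ?_⟩, ⟨σ.real 1 o x, hs0 _ _, ?_, ?_⟩, ?_⟩
    · intro g hg
      rw [hst']
      split
      case isTrue hgx => exact Or.inr ⟨rfl, by rw [hgx, hlabx]⟩
      case isFalse hgx => exact h.status g hg
    · intro g hg hne
      by_cases hgx : g = x
      · rw [hgx, h2']; omega
      · rw [hst', if_neg hgx] at hne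
        exact (hp.lt g hg hne).trans (by omega)
    · intro g hg k hk hg2 hgl hk2 hkl hgk
      by_cases hgo : σ.nat 1 0 g = o
      · rw [honly g hg hgo hg2, honly k hk (hgk ▸ hgo) hk2]
      · have hgx : g ≠ x := by rintro rfl; exact hgo h2'
        have hkx : k ≠ x := by rintro rfl; exact hgo (hgk ▸ h2')
        rw [hst', if_neg hgx] at hg2
        rw [hst', if_neg hkx] at hk2
        exact hp.unique g hg k hk hg2 hgl hk2 hkl hgk
    · intro g hg hgo hg0
      exact h3 g hg ⟨hfree g hg hgo, hgo⟩
    · intro b hb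
      have e1 : (Finset.range m).filter (fun g => σ.nat 1 0 g = o ∧ st' g = 2) = {x} := by
        ext g
        simp only [Finset.mem_filter, Finset.mem_range, Finset.mem_singleton]
        refine ⟨fun hh => honly g hh.1 hh.2.1 hh.2.2, ?_⟩
        rintro rfl
        exact ⟨h1, h2', by simp [hst']⟩
      have e2 : (Finset.range m).filter (fun g => σ.nat 1 0 g = o ∧ st' g = 2 ∧
          (σ.nat 5 0 g = b ∨ σ.nat 5 0 g = n)) = {x} := by
        ext g
        simp only [Finset.mem_filter, Finset.mem_range, Finset.mem_singleton]
        refine ⟨fun hh => honly g hh.1 hh.2.1 hh.2.2.1, ?_⟩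
        rintro rfl
        exact ⟨h1, h2', by simp [hst'], Or.inr hlabx⟩
      rw [e1, e2, Finset.sum_singleton]
      linarith
    · intro g hg hg2
      rw [hst', hg2]
      simp

theorem run_allocate {σ : Mem} {n m : ℕ} (hn0 : 0 < n) (hn : σ.nat 0 0 0 = n)
    (hm : σ.nat 0 0 1 = m) (hv0 : ∀ i g, 0 ≤ σ.real 0 i g) (hs0 : ∀ i g, 0 ≤ σ.real 1 i g)
    (h : FairState n m (σ.real 0) (σ.nat 4 0) (σ.nat 6 0) (σ.nat 5 0) (σ.real 2))
    (hp : Permanent n m 0 (σ.nat 1 0) (σ.nat 6 0) (σ.nat 5 0)) {τ : Mem}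
    (hτ : allocate.run σ = τ) :
    FairState n m (σ.real 0) (τ.nat 4 0) (τ.nat 6 0) (τ.nat 5 0) (τ.real 2) ∧
    Permanent n m n (σ.nat 1 0) (τ.nat 6 0) (τ.nat 5 0) ∧
    ∀ o < n, Served n m o (σ.nat 1 0) (σ.real 1 o) (τ.nat 6 0) (τ.nat 5 0) := by
  subst hτ
  refine run_rep hn (fun o τ =>
    FairState n m (σ.real 0) (τ.nat 4 0) (τ.nat 6 0) (τ.nat 5 0) (τ.real 2) ∧
    Permanent n m o (σ.nat 1 0) (τ.nat 6 0) (τ.nat 5 0) ∧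
    ∀ p < o, Served n m p (σ.nat 1 0) (σ.real 1 p) (τ.nat 6 0) (τ.nat 5 0)) (by decide) ?_ ?_
  · simpa using ⟨h, hp⟩
  · rintro o τ ho hτo hfn hfr ⟨hF, hP, hS⟩
    have f0 : τ.nat 0 = σ.nat 0 := hfn 0 (by decide)
    have f1 : τ.nat 1 = σ.nat 1 := hfn 1 (by decide)
    have r0 : τ.real 0 = σ.real 0 := hfr 0 (by decide)
    have r1 : τ.real 1 = σ.real 1 := hfr 1 (by decide)
    simp only [ne_eq, Nat.reduceEqDiff, not_false_eq_true, Mem.writeNat_nat_of_ne,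
      Mem.writeNat_real]
    rw [run_seq]
    generalize hA : (seq select (mark 2)).run τ = A
    obtain ⟨h1, h2, h3, h4⟩ := run_permanent (by rw [f0, hm]) hτo (by rw [r1]; exact hs0) hF
      (by rw [f1]; exact hP) hA
    have A0 : A.nat 0 = τ.nat 0 := by rw [← hA]; exact run_nat_of_notMem _ (by decide) _
    have A1 : A.nat 1 = τ.nat 1 := by rw [← hA]; exact run_nat_of_notMem _ (by decide) _
    have A4 : A.nat 4 = τ.nat 4 := by rw [← hA]; exact run_nat_of_notMem _ (by decide) _
    have A5 : A.nat 5 = τ.nat 5 := by rw [← hA]; exact run_nat_of_notMem _ (by decide) _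
    have A13 : A.nat 13 = τ.nat 13 := by rw [← hA]; exact run_nat_of_notMem _ (by decide) _
    have a0 : A.real 0 = τ.real 0 := by rw [← hA]; exact run_real_of_notMem _ (by decide) _
    have a1 : A.real 1 = τ.real 1 := by rw [← hA]; exact run_real_of_notMem _ (by decide) _
    have a2 : A.real 2 = τ.real 2 := by rw [← hA]; exact run_real_of_notMem _ (by decide) _
    rw [← A5, f1] at h2 h3
    rw [← A4, ← A5, ← a2] at h1
    rw [r1] at h3
    have key := run_rep (n := m) (σ := A) (by rw [A0, f0, hm]) (c := 14) (p := block) (fun k τ =>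
      FairState n m (σ.real 0) (τ.nat 4 0) (τ.nat 6 0) (τ.nat 5 0) (τ.real 2) ∧
      Permanent n m (o + 1) (σ.nat 1 0) (τ.nat 6 0) (τ.nat 5 0) ∧
      (∀ p < o, Served n m p (σ.nat 1 0) (σ.real 1 p) (τ.nat 6 0) (τ.nat 5 0)) ∧
      (∃ μ, Progress n m o (σ.nat 1 0) (σ.real 1 o) (τ.nat 6 0) (τ.nat 5 0) μ) ∧
      (freeGoods m o (σ.nat 1 0) (τ.nat 6 0)).card ≤ m - k) (by decide) ?_ ?_
    · obtain ⟨k1, k2, k3, ⟨μ, k4⟩, k5⟩ := key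
      refine ⟨k1, k2, fun p hp => ?_⟩
      rcases Nat.lt_succ_iff_lt_or_eq.1 hp with hp | rfl
      · exact k3 p hp
      · refine k4.served fun g hg hgp => ?_
        rcases k1.status g hg with k6 | k6
        · exfalso
          have : g ∈ freeGoods m p (σ.nat 1 0) (((rep 14 1 block).run A).nat 6 0) := by
            simp only [freeGoods, Finset.mem_filter, Finset.mem_range]
            exact ⟨hg, hgp, k6.1⟩
          have := Finset.card_pos.2 ⟨g, this⟩
          omega
        · exact k6.1
    · simp only [ne_eq, Nat.reduceEqDiff, not_false_eq_true, Mem.writeNat_nat_of_ne,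
        Mem.writeNat_real]
      refine ⟨h1, h2, fun p hp => (hS p hp).congr fun g hg hg2 => ⟨h4 g hg hg2, by rw [A5]⟩, h3, ?_⟩
      exact (Finset.card_filter_le _ _).trans (by simp)
    · rintro k π hk hπk hfn' hfr' ⟨k1, k2, k3, ⟨μ, k4⟩, k5⟩
      have p0 : π.nat 0 = σ.nat 0 := (hfn' 0 (by decide)).trans (A0.trans f0)
      have p1 : π.nat 1 = σ.nat 1 := (hfn' 1 (by decide)).trans (A1.trans f1)
      have p13 : π.nat 13 0 0 = o := by rw [hfn' 13 (by decide), A13, hτo]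
      have q0 : π.real 0 = σ.real 0 := (hfr' 0 (by decide)).trans (a0.trans r0)
      have q1 : π.real 1 = σ.real 1 := (hfr' 1 (by decide)).trans (a1.trans r1)
      obtain ⟨b1, Q, b2⟩ := run_block (σ := π) (n := n) (m := m) (by rw [p0, hn]) (by rw [p0, hm])
        p13 (by rw [q0]; exact hv0) (by rw [q0]; exact k1)
      rw [q0] at b1
      rw [p1, q1] at b2
      simp only [ne_eq, Nat.reduceEqDiff, not_false_eq_true, Mem.writeNat_nat_of_ne,
        Mem.writeNat_real]
      refine ⟨b1, b2.permanent (by omega) k2, fun p hp => b2.served (k3 p hp),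
        k4.blockStep b2 (hs0 o) hn0, ?_⟩
      have := b2.card_freeGoods hn0
      omega

theorem run_setup {σ : Mem} {n m : ℕ} (hn0 : 0 < n) (hn : σ.nat 0 0 0 = n)
    (hm : σ.nat 0 0 1 = m) {τ : Mem} (hτ : setup.run σ = τ) :
    (∀ g < m, τ.nat 1 0 g < n ∧ ∀ i < n, σ.real 1 i g ≤ σ.real 1 (τ.nat 1 0 g) g) ∧
    (∀ g < m, τ.nat 5 0 g = n) ∧ ∀ i < n, τ.nat 4 0 i = i := by
  subst hτ
  have h1 := run_rep hm (c := 13)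
    (p := seq (argmax 0 (.natLe (.const 0) (.const 0)) (.read 1 (scalar 21) (scalar 13)))
      (seq (setNat 1 (.const 0) (scalar 13) (scalar 20))
        (setNat 5 (.const 0) (scalar 13) (bound 0))))
    (fun k τ => (∀ g < k, τ.nat 1 0 g < n ∧ ∀ i < n, σ.real 1 i g ≤ σ.real 1 (τ.nat 1 0 g) g) ∧
      ∀ g < k, τ.nat 5 0 g = n) (by decide) (by simp) ?_
  · rw [setup, run_seq]
    set A := (rep 13 1 (seq (argmax 0 (.natLe (.const 0) (.const 0))
      (.read 1 (scalar 21) (scalar 13))) (seq (setNat 1 (.const 0) (scalar 13) (scalar 20))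
        (setNat 5 (.const 0) (scalar 13) (bound 0))))).run σ
    have A0 : A.nat 0 = σ.nat 0 := run_nat_of_notMem _ (by decide) _
    rw [run_nat_of_notMem _ (show 1 ∉ _ by decide), run_nat_of_notMem _ (show 5 ∉ _ by decide)]
    refine ⟨h1.1, h1.2, ?_⟩
    refine run_rep (n := n) (by rw [A0, hn]) (fun k τ => ∀ i < k, τ.nat 4 0 i = i) (by decide)
      (by simp) ?_
    intro k τ hk hτk hfn hfr hI i hi
    simp only [run_setNat, NExp.eval, hτk, ne_eq, Nat.reduceEqDiff, not_false_eq_true,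
      Mem.writeNat_nat_of_ne, Mem.writeNat_nat, true_and]
    split
    case isTrue h => exact h.symm
    case isFalse h => exact hI i (by omega)
  · rintro k τ hk hτk hfn hfr ⟨hI1, hI2⟩
    have f0 : τ.nat 0 = σ.nat 0 := hfn 0 (by decide)
    have r1 : τ.real 1 = σ.real 1 := hfr 1 (by decide)
    rw [run_seq]
    generalize hρ : Prog.run (argmax _ _ _) τ = ρ
    obtain ⟨hsf, hr⟩ := run_argmax _ _ _ τ (fun _ => True) (fun i => σ.real 1 i k)
      (fun ρ hρ => by simp [BExp.Holds])
      (fun ρ hρ => by simp [RExp.eval, NExp.eval, hρ.1, hρ.2, r1, hτk]) hρ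
    have g0 : ρ.nat 0 = τ.nat 0 := hsf.1 0 (by decide) (by decide)
    have g1 : ρ.nat 1 = τ.nat 1 := hsf.1 1 (by decide) (by decide)
    have g5 : ρ.nat 5 = τ.nat 5 := hsf.1 5 (by decide) (by decide)
    have g13 : ρ.nat 13 = τ.nat 13 := hsf.1 13 (by decide) (by decide)
    rw [f0, hn] at hr
    -- The search cannot fail because there is at least one agent.
    replace hr := hr.resolve_left fun hh => hh.2 0 hn0 trivial
    simp only [run_seq, run_setNat, NExp.eval, hτk, ne_eq, Nat.reduceEqDiff, not_false_eq_true,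
      Mem.writeNat_nat_of_ne, Mem.writeNat_nat, true_and, g0, g1, g5, g13, f0, hn, zero_ne_one,
      OfNat.one_ne_ofNat]
    refine ⟨fun g hg => ?_, fun g hg => ?_⟩
    · split
      case isTrue h => subst h; exact ⟨hr.1, fun i hi => hr.2.2 i hi trivial⟩
      case isFalse h => exact hI1 g (by omega)
    · split
      · rfl
      · exact hI2 g (by omega)

theorem run_finish {σ : Mem} {n m : ℕ} (hn : σ.nat 0 0 0 = n) (hm : σ.nat 0 0 1 = m)
    (hinj : ∀ i < n, ∀ j < n, σ.nat 4 0 i = σ.nat 4 0 j → i = j) :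
    ∀ g < m, (∀ i < n, σ.nat 5 0 g = σ.nat 4 0 i → (finish.run σ).nat 1 0 g = i) ∧
      ((∀ i < n, σ.nat 5 0 g ≠ σ.nat 4 0 i) → (finish.run σ).nat 1 0 g = σ.nat 1 0 g) := by
  have key := run_rep hm (c := 13) (p := rep 14 0 (cond
    (.and (.natLe (entry 5 (scalar 13)) (entry 4 (scalar 14)))
      (.natLe (entry 4 (scalar 14)) (entry 5 (scalar 13))))
    (setNat 1 (.const 0) (scalar 13) (scalar 14))))
    (fun k τ => (∀ g < k, (∀ i < n, σ.nat 5 0 g = σ.nat 4 0 i → τ.nat 1 0 g = i) ∧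
      ((∀ i < n, σ.nat 5 0 g ≠ σ.nat 4 0 i) → τ.nat 1 0 g = σ.nat 1 0 g)) ∧
      ∀ g, k ≤ g → τ.nat 1 0 g = σ.nat 1 0 g) (by decide) (by simp) ?_
  · exact key.1
  rintro k τ hk hτk hfn hfr ⟨hI1, hI2⟩
  have f0 : τ.nat 0 = σ.nat 0 := hfn 0 (by decide)
  have f4 : τ.nat 4 = σ.nat 4 := hfn 4 (by decide)
  have f5 : τ.nat 5 = σ.nat 5 := hfn 5 (by decide)
  rw [Mem.writeNat_nat_of_ne _ (by decide)]
  have key := run_rep (n := n) (σ := τ) (by rw [f0, hn]) (c := 14) (p := cond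
    (.and (.natLe (entry 5 (scalar 13)) (entry 4 (scalar 14)))
      (.natLe (entry 4 (scalar 14)) (entry 5 (scalar 13))))
    (setNat 1 (.const 0) (scalar 13) (scalar 14)))
    (fun j π => (∀ i < j, σ.nat 5 0 k = σ.nat 4 0 i → π.nat 1 0 k = i) ∧
      ((∀ i < j, σ.nat 5 0 k ≠ σ.nat 4 0 i) → π.nat 1 0 k = σ.nat 1 0 k) ∧
      ∀ g, g ≠ k → π.nat 1 0 g = τ.nat 1 0 g) (by decide) (by simp [hI2]) ?_
  · refine ⟨fun g hg => ?_, fun g hg => ?_⟩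
    · by_cases hgk : g = k
      · subst hgk
        exact ⟨key.1, key.2.1⟩
      · rw [key.2.2 g hgk]
        exact hI1 g (by omega)
    · rw [key.2.2 g (by omega)]
      exact hI2 g (by omega)
  rintro j π hj hπj hfn' hfr' ⟨hJ1, hJ2, hJ3⟩
  have p4 : π.nat 4 = σ.nat 4 := (hfn' 4 (by decide)).trans f4
  have p5 : π.nat 5 = σ.nat 5 := (hfn' 5 (by decide)).trans f5
  have p13 : π.nat 13 0 0 = k := by rw [hfn' 13 (by decide), hτk]
  rw [Mem.writeNat_nat_of_ne _ (by decide)]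
  by_cases htest : σ.nat 5 0 k = σ.nat 4 0 j
  · rw [run_cond_of_holds (by simp [BExp.Holds, NExp.eval, p4, p5, p13, hπj, htest])]
    simp only [run_setNat, NExp.eval, p13, hπj, Mem.writeNat_nat, and_self, if_true, true_and]
    refine ⟨fun i hi h => hinj j hj i (by omega) (htest ▸ h), fun h => absurd htest (h j (by omega)),
      fun g hg => ?_⟩
    rw [if_neg hg]
    exact hJ3 g hg
  · rw [run_cond_of_not_holds (by
      simp only [BExp.Holds, NExp.eval, p4, p5, p13, hπj]; omega)]
    refine ⟨fun i hi h => ?_, fun h => hJ2 fun i hi => h i (by omega), hJ3⟩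
    have : i ≠ j := by rintro rfl; exact htest h
    exact hJ1 i (by omega) h

end Prog
end SocialImpact

namespace SocialImpact

/-! ### The final allocation -/

/-- The outcome of the program: `owner` is the agent with the largest social impact, and the
recipient `out g` is the owner of the bundle with label `lab g` if there is one, and `owner g`
otherwise. -/
structure Outcome (n m : ℕ) (v s : ℕ → ℕ → ℝ) (owner own st lab : ℕ → ℕ) (V : ℕ → ℕ → ℝ)
    (out : ℕ → ℕ) : Prop where
  fair : FairState n m v own st lab V
  permanent : Permanent n m n owner st lab
  served : ∀ o < n, Served n m o owner (s o) st lab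
  owner_lt : ∀ g < m, owner g < n
  owner_max : ∀ g < m, ∀ i < n, s i g ≤ s (owner g) g
  out_of_eq : ∀ g < m, ∀ i < n, lab g = own i → out g = i
  out_of_ne : ∀ g < m, (∀ i < n, lab g ≠ own i) → out g = owner g

namespace Outcome

variable {n m : ℕ} {v s : ℕ → ℕ → ℝ} {owner own st lab : ℕ → ℕ} {V : ℕ → ℕ → ℝ} {out : ℕ → ℕ}

theorem label (h : Outcome n m v s owner own st lab V out) {g : ℕ} (hg : g < m) :
    (∃ i < n, lab g = own i) ∨ (lab g = n ∧ st g = 2) := by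
  have h1 : st g = 2 := (h.served _ (h.owner_lt g hg)).allocated g hg rfl
  rcases h.fair.status g hg with h2 | h2
  · omega
  · rcases h2.2.lt_or_eq with h3 | h3
    · obtain ⟨i, hi, hio⟩ := exists_eq_of_injective_lt h.fair.own_lt h.fair.own_inj h3
      exact Or.inl ⟨i, hi, hio.symm⟩
    · exact Or.inr ⟨h3, h1⟩

theorem out_of_label_eq (h : Outcome n m v s owner own st lab V out) {g : ℕ} (hg : g < m)
    (hl : lab g = n) : out g = owner g :=
  h.out_of_ne g hg fun i hi hh => by
    have := h.fair.own_lt i hi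
    omega

theorem out_lt (h : Outcome n m v s owner own st lab V out) {g : ℕ} (hg : g < m) : out g < n := by
  rcases h.label hg with ⟨i, hi, h1⟩ | ⟨h1, -⟩
  · rw [h.out_of_eq g hg i hi h1]
    exact hi
  · rw [h.out_of_label_eq hg h1]
    exact h.owner_lt g hg

/-- The final allocation is envy-free up to two goods. -/
theorem envyFree (h : Outcome n m v s owner own st lab V out) (hv : ∀ i g, 0 ≤ v i g) {i j : ℕ}
    (hi : i < n) (hj : j < n) : ∃ R ⊆ labelled m out j, R.card ≤ 2 ∧
      ∑ g ∈ labelled m out j \ R, v i g ≤ ∑ g ∈ labelled m out i, v i g := by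
  classical
  have hsub : ∀ k < n, labelled m lab (own k) ⊆ labelled m out k := by
    intro k hk g hg
    rw [mem_labelled] at hg ⊢
    exact ⟨hg.1, h.out_of_eq g hg.1 k hk hg.2⟩
  obtain ⟨R, hR, hc, hs⟩ := h.fair.ef i hi j hj
  set P := (labelled m out j).filter (lab · = n) with hP
  -- A good with label `n` that `j` receives is owned by `j`, so it is the permanent good of `j`.
  have hPc : P.card ≤ 1 := by
    rw [Finset.card_le_one]
    intro a ha b hb
    simp only [hP, Finset.mem_filter, mem_labelled] at ha hb
    obtain ⟨⟨ham, hao⟩, hal⟩ := ha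
    obtain ⟨⟨hbm, hbo⟩, hbl⟩ := hb
    rw [h.out_of_label_eq ham hal] at hao
    rw [h.out_of_label_eq hbm hbl] at hbo
    exact h.permanent.unique a ham b hbm ((h.served j hj).allocated a ham hao) hal
      ((h.served j hj).allocated b hbm hbo) hbl (hao.trans hbo.symm)
  refine ⟨R ∪ P, Finset.union_subset (hR.trans (hsub j hj)) (Finset.filter_subset _ _),
    (Finset.card_union_le _ _).trans (by omega), ?_⟩
  calc ∑ g ∈ labelled m out j \ (R ∪ P), v i g ≤ ∑ g ∈ labelled m lab (own j) \ R, v i g := by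
        refine Finset.sum_le_sum_of_subset_of_nonneg ?_ fun g _ _ => hv i g
        intro g hg
        simp only [hP, Finset.mem_sdiff, Finset.mem_union, Finset.mem_filter, not_or, not_and,
          mem_labelled] at hg ⊢
        obtain ⟨⟨hgm, hgo⟩, hgR, hgP⟩ := hg
        refine ⟨⟨hgm, ?_⟩, hgR⟩
        rcases h.label hgm with ⟨k, hk, h1⟩ | ⟨h1, -⟩
        · have := h.out_of_eq g hgm k hk h1
          rw [h1, ← this, hgo]
        · exact absurd h1 (hgP ⟨hgm, hgo⟩)
    _ ≤ ∑ g ∈ labelled m lab (own i), v i g := hs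
    _ ≤ ∑ g ∈ labelled m out i, v i g :=
        Finset.sum_le_sum_of_subset_of_nonneg (hsub i hi) fun g _ _ => hv i g

/-- Every agent has her share of the social impact of the goods that she owns. -/
theorem share (h : Outcome n m v s owner own st lab V out) (hs : ∀ i g, 0 ≤ s i g) {o : ℕ}
    (ho : o < n) :
    ∑ g ∈ labelled m owner o, s o g ≤ n * ∑ g ∈ labelled m out o, s o g := by
  refine ((h.served o ho).share (own o) (h.fair.own_lt o ho)).trans ?_
  refine mul_le_mul_of_nonneg_left ?_ (Nat.cast_nonneg n)
  refine Finset.sum_le_sum_of_subset_of_nonneg ?_ fun g _ _ => hs o g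
  intro g hg
  simp only [Finset.mem_filter, Finset.mem_range, mem_labelled] at hg ⊢
  refine ⟨hg.1, ?_⟩
  rcases hg.2.2 with h1 | h1
  · exact h.out_of_eq g hg.1 o ho h1
  · rw [h.out_of_label_eq hg.1 h1, hg.2.1]

/-- The allocation in which good `g` is given to `out g`. -/
def allocation (h : Outcome n m v s owner own st lab V out) : Allocation n m where
  bundle i := Finset.univ.filter fun g => out g = i
  disjoint i j hij := by
    rw [Finset.disjoint_left]
    intro g hg hg'
    simp only [Finset.mem_filter, Finset.mem_univ, true_and] at hg hg'
    exact hij (Fin.ext (hg.symm.trans hg'))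
  complete g := ⟨⟨out g, h.out_lt g.2⟩, by simp⟩

end Outcome

/-! ### From natural indices back to `Fin`, and assembly -/

theorem bundleValue_filter {m : ℕ} {f : Fin m → ℝ} {F : ℕ → ℝ} (hF : ∀ g : Fin m, F g = f g)
    {S : Finset ℕ} (hS : S ⊆ Finset.range m) {B : Finset (Fin m)}
    (hB : ∀ g : Fin m, g ∈ B ↔ (g : ℕ) ∈ S) : bundleValue f B = ∑ g ∈ S, F g := by
  refine Finset.sum_bij (fun g _ => (g : ℕ)) (fun g hg => (hB g).1 hg)
    (fun a _ b _ hab => Fin.ext hab) (fun g hg => ?_) (fun g _ => (hF g).symm)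
  exact ⟨⟨g, Finset.mem_range.1 (hS hg)⟩, (hB _).2 hg, rfl⟩

theorem labelled_subset_range (m : ℕ) (lab : ℕ → ℕ) (b : ℕ) :
    labelled m lab b ⊆ Finset.range m := Finset.filter_subset _ _

theorem Outcome.isEFk {n m : ℕ} {v s : ℕ → ℕ → ℝ} {owner own st lab : ℕ → ℕ} {V : ℕ → ℕ → ℝ}
    {out : ℕ → ℕ} (h : Outcome n m v s owner own st lab V out) (I : FairInstance n m)
    (hv : ∀ i g, 0 ≤ v i g) (hvI : ∀ (i : Fin n) (g : Fin m), v i g = I.v i g) :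
    IsEFk 2 I h.allocation := by
  intro i j
  obtain ⟨R, hR, hc, hs⟩ := h.envyFree hv i.2 j.2
  have hB : ∀ (k : Fin n) (g : Fin m), g ∈ h.allocation.bundle k ↔ (g : ℕ) ∈ labelled m out k := by
    intro k g
    simp [Outcome.allocation, mem_labelled]
  refine ⟨Finset.univ.filter fun g => (g : ℕ) ∈ R, ?_, ?_, ?_⟩
  · intro g hg
    exact (hB j g).2 (hR (Finset.mem_filter.1 hg).2)
  · refine le_trans ?_ hc
    refine Finset.card_le_card_of_injOn (fun g : Fin m => (g : ℕ)) ?_ fun a _ b _ hab => Fin.ext hab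
    intro g hg
    simpa using hg
  · rw [bundleValue_filter (hvI i) (labelled_subset_range m out i) (hB i),
      bundleValue_filter (hvI i) (Finset.sdiff_subset.trans (labelled_subset_range m out j))
        (fun g => ?_)]
    · exact hs
    · simp [hB]

/-- Any allocation is dominated by giving each good to its owner, and that welfare splits by owner
into sums to which `Outcome.share` applies. -/
theorem Outcome.isMaxUtApprox {n m : ℕ} {v s : ℕ → ℕ → ℝ} {owner own st lab : ℕ → ℕ}
    {V : ℕ → ℕ → ℝ} {out : ℕ → ℕ} (h : Outcome n m v s owner own st lab V out)
    (I : FairInstance n m) (hs : ∀ i g, 0 ≤ s i g)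
    (hsI : ∀ (i : Fin n) (g : Fin m), s i g = I.s i g) : IsMaxUtApprox n I h.allocation := by
  classical
  intro B
  have hB : ∀ (k : Fin n) (g : Fin m), g ∈ h.allocation.bundle k ↔ (g : ℕ) ∈ labelled m out k := by
    intro k g
    simp [Outcome.allocation, mem_labelled]
  let ow : Fin m → Fin n := fun g => ⟨owner g, h.owner_lt g g.2⟩
  have hmax : ∀ (i : Fin n) (g : Fin m), I.s i g ≤ I.s (ow g) g := fun i g => by
    rw [← hsI, ← hsI]
    exact h.owner_max g g.2 i i.2
  calc socialWelfare I B ≤ ∑ i, ∑ g ∈ B.bundle i, I.s (ow g) g :=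
        Finset.sum_le_sum fun i _ => Finset.sum_le_sum fun g _ => hmax i g
    _ = ∑ g, I.s (ow g) g := by
        rw [← Finset.sum_biUnion fun i _ j _ hij => B.disjoint i j hij]
        congr 1
        ext g
        simpa using B.complete g
    _ = ∑ o, ∑ g with ow g = o, I.s (ow g) g := (Finset.sum_fiberwise _ _ _).symm
    _ = ∑ o, bundleValue (I.s o) (Finset.univ.filter (ow · = o)) := by
        refine Finset.sum_congr rfl fun o _ => Finset.sum_congr rfl fun g hg => ?_
        rw [(Finset.mem_filter.1 hg).2]
    _ ≤ ∑ o, n * bundleValue (I.s o) (h.allocation.bundle o) := by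
        refine Finset.sum_le_sum fun o _ => ?_
        rw [bundleValue_filter (hsI o) (labelled_subset_range m out o) (hB o),
          bundleValue_filter (hsI o) (labelled_subset_range m owner o) (fun g => ?_)]
        · exact h.share hs o.2
        · simp [mem_labelled, ow, Fin.ext_iff]
    _ = n * socialWelfare I h.allocation := by rw [socialWelfare, Finset.mul_sum]

theorem inputMem_real_zero_nonneg {n m : ℕ} (I : FairInstance n m) (i g : ℕ) :
    0 ≤ (inputMem I).real 0 i g := by
  simp only [inputMem, if_true]
  split
  · exact I.v_nonneg _ _
  · exact le_rfl

theorem inputMem_real_one_nonneg {n m : ℕ} (I : FairInstance n m) (i g : ℕ) :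
    0 ≤ (inputMem I).real 1 i g := by
  simp only [inputMem, one_ne_zero, if_false, if_true]
  split
  · exact I.s_nonneg _ _
  · exact le_rfl

theorem run_whole {n m : ℕ} (hn : 0 < n) (I : FairInstance n m) {σ : Mem}
    (hσ : Prog.whole.run (inputMem I) = σ) :
    ∃ owner own st lab V, Outcome n m ((inputMem I).real 0) ((inputMem I).real 1)
      owner own st lab V (σ.nat 1 0) := by
  subst hσ
  set ι := inputMem I with hι
  have i0 : ι.nat 0 0 0 = n := by simp [hι, inputMem]
  have i1 : ι.nat 0 0 1 = m := by simp [hι, inputMem]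
  rw [Prog.whole, Prog.run_seq, Prog.run_seq]
  generalize hA : Prog.setup.run ι = A
  obtain ⟨a1, a2, a3⟩ := Prog.run_setup hn i0 i1 hA
  have A0 : A.nat 0 = ι.nat 0 := by rw [← hA]; exact Prog.run_nat_of_notMem _ (by decide) _
  -- The default `0` of the input memory serves as initialisation: all goods are free, and the empty
  -- bundles have value `0`.
  have A6 : ∀ g, A.nat 6 0 g = 0 := fun g => by
    rw [← hA, Prog.run_nat_of_notMem _ (by decide)]
    simp [hι, inputMem]
  have B0 : A.real 0 = ι.real 0 := by rw [← hA]; exact Prog.run_real_of_notMem _ (by decide) _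
  have B1 : A.real 1 = ι.real 1 := by rw [← hA]; exact Prog.run_real_of_notMem _ (by decide) _
  have B2 : ∀ i b, A.real 2 i b = 0 := fun i b => by
    rw [← hA, Prog.run_real_of_notMem _ (by decide)]
    simp [hι, inputMem]
  have hlab : ∀ b < n, labelled m (A.nat 5 0) b = ∅ := by
    intro b hb
    rw [Finset.eq_empty_iff_forall_notMem]
    intro g hg
    rw [mem_labelled] at hg
    have := a2 g hg.1
    omega
  have hfair : FairState n m (A.real 0) (A.nat 4 0) (A.nat 6 0) (A.nat 5 0) (A.real 2) := by
    refine ⟨fun i hi => by rw [a3 i hi]; exact hi, fun i hi j hj hij => ?_, fun i _ b hb => ?_,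
      fun i hi j hj => ?_, fun g hg => Or.inl ⟨A6 g, a2 g hg⟩⟩
    · rwa [a3 i hi, a3 j hj] at hij
    · rw [B2, hlab b hb, Finset.sum_empty]
    · rw [a3 i hi, a3 j hj, hlab i hi, hlab j hj]
      exact ⟨∅, by simp⟩
  generalize hC : Prog.allocate.run A = C
  obtain ⟨c1, c2, c3⟩ := Prog.run_allocate hn (by rw [A0, i0]) (by rw [A0, i1])
    (by rw [B0]; exact inputMem_real_zero_nonneg I) (by rw [B1]; exact inputMem_real_one_nonneg I)
    hfair ⟨fun g _ h => absurd (A6 g) h, fun g _ k _ h => by simp [A6] at h⟩ hC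
  have C0 : C.nat 0 = A.nat 0 := by rw [← hC]; exact Prog.run_nat_of_notMem _ (by decide) _
  have C1 : C.nat 1 = A.nat 1 := by rw [← hC]; exact Prog.run_nat_of_notMem _ (by decide) _
  have hD := Prog.run_finish (σ := C) (n := n) (m := m) (by rw [C0, A0, i0]) (by rw [C0, A0, i1])
    c1.own_inj
  rw [B0] at c1
  rw [B1] at c3
  exact ⟨A.nat 1 0, C.nat 4 0, C.nat 6 0, C.nat 5 0, C.real 2, c1, c2, c3,
    fun g hg => (a1 g hg).1, fun g hg => (a1 g hg).2, fun g hg => (hD g hg).1,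
    fun g hg hh => by rw [(hD g hg).2 hh, C1]⟩

end SocialImpact

theorem theorem5 :
    ∃ (c : SocialImpact.Cmd) (p : Polynomial ℕ),
      ∀ (n m : ℕ), 0 < n → ∀ I : SocialImpact.FairInstance n m,
        ∃ (t : ℕ) (σ : SocialImpact.Mem) (A : SocialImpact.Allocation n m),
          SocialImpact.Exec c (SocialImpact.inputMem I) t σ ∧
          t ≤ p.eval (n + m) ∧
          SocialImpact.IsOutput σ A ∧
          SocialImpact.IsEFk 2 I A ∧
          SocialImpact.IsMaxUtApprox (n : ℝ) I A := by
  refine ⟨SocialImpact.Prog.whole.toCmd, SocialImpact.Prog.whole.time, fun n m hn I => ?_⟩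
  -- Every possible loop bound is `n`, `m` or `0`, so the time polynomial may be evaluated at `n +
  -- m`.
  obtain ⟨t, ht, he⟩ := SocialImpact.Prog.exec_toCmd _ SocialImpact.Prog.wellFormed_whole
    (by decide) (n + m) (SocialImpact.inputMem I) fun b => by
      simp only [SocialImpact.inputMem]
      split_ifs <;> omega
  obtain ⟨owner, own, st, lab, V, h⟩ := SocialImpact.run_whole hn I rfl
  refine ⟨t, _, h.allocation, he, ht, fun i g => ?_, ?_, ?_⟩
  · simp [SocialImpact.Outcome.allocation]
  · exact h.isEFk I (SocialImpact.inputMem_real_zero_nonneg I) fun i g => by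
      simp [SocialImpact.inputMem]
  · exact h.isMaxUtApprox I (SocialImpact.inputMem_real_one_nonneg I) fun i g => by
      simp [SocialImpact.inputMem]
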